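/- For complex $\alpha,\alpha',\beta,\beta',\gamma$ with $\operatorname{Re}\gamma>0$ and $x>0$, let $$\left(I_{0,+}^{\alpha,\alpha',\beta,\beta',\gamma}f\right)(x)=\frac{x^{-\alpha}}{\Gamma(\gamma)}\int_0^x (x-t)^{\gamma-1}t^{-\alpha'}F_3\!\left(\alpha,\alpha',\beta,\beta';\gamma;1-\tfrac tx,1-\tfrac xt\right)f(t)\,dt,$$ where $F_3$ is Appell's function $$F_3(a,a',b,b';c;u,v)=\sum_{m,n\ge0}\frac{(a)_m(a')_n(b)_m(b')_n}{(c)_{m+n}\,m!\,n!}u^mv^n\qquad(|u|,|v|<1),$$ continued analytically from the origin to $(u,v)$ along the straight segment. Let $${}_p\psi_q\left[\begin{matrix}(a_i,\alpha_i)_{1,p}\\(b_j,\beta_j)_{1,q}\end{matrix}\,\Big|\,z\right]=\sum_{k=0}^\infty\frac{\prod_{i=1}^p\Gamma(a_i+\alpha_ik)}{\prod_{j=1}^q\Gamma(b_j+\beta_jk)}\frac{z^k}{k!}$$ be the generalized Wright function (with $1/\Gamma=0$ at the poles of $\Gamma$). **Corollary.** Let $\alpha,\alpha',\beta,\beta',\gamma,\rho,c\in\mathbb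 C$ be such that $\operatorname{Re}\gamma>0$ and $$\operatorname{Re}\rho>\max\{0,\operatorname{Re}(\alpha+\alpha'+\beta-\gamma),\operatorname{Re}(\alpha'-\beta')\},$$ and let $x>0$. Then $$\left(I_{0,+}^{\alpha,\alpha',\beta,\beta',\gamma}\,t^{\rho-1}\cos(ct)\right)(x)=\sqrt\pi\,x^{\rho-\alpha-\alpha'+\gamma-1}\;{}_3\psi_4\left[\begin{matrix}(\rho,2),(\rho+\gamma-\alpha-\alpha'-\beta,2),(\rho+\beta'-\alpha',2)\\(\rho+\beta',2),(\rho+\gamma-\alpha-\alpha',2),(\rho+\gamma-\alpha'-\beta,2),(\tfrac12,1)\end{matrix}\,\Big|\,-\frac{c^2x^2}{4}\right]$$ and $$\left(I_{0,+}^{\alpha,\alpha',\beta,\beta',\gamma}\,t^{\rho-1}\cosh(ct)\right)(x)=\sqrt\pi\,x^{\rho-\alpha-\alpha'+\gamma-1}\;{}_3\psi_4\left[\begin{matrix}(\rho,2),(\rho+\gamma-\alpha-\alpha'-\beta,2),(\rho+\beta'-\alpha',2)\\(\rho+\beta',2),(\rho+\gamma-\alpha-\alpha',2),(\rho+\gamma-\alpha'-\beta,2),(\tfrac12,1)\end{matrix}\,\Big|\,\frac{c^2x^2}{4}\right],$$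 where the integrands on the left are absolutely integrable on $(0,x)$ and the series on the right converge absolutely. -/

import Mathlib

open Filter Topology

noncomputable section

/-- The general term `(a)_m (a')_n (b)_m (b')_n / ((c)_{m+n} m! n!) x^m y^n` of Appell's double
series `F₃`. -/
def appellF3Term (a a' b b' c x y : ℂ) (i : ℕ × ℕ) : ℂ :=
  (ascPochhammer ℂ i.1).eval a * (ascPochhammer ℂ i.2).eval a' *
      (ascPochhammer ℂ i.1).eval b * (ascPochhammer ℂ i.2).eval b' /
    ((ascPochhammer ℂ (i.1 + i.2)).eval c * (i.1.factorial : ℂ) * (i.2.factorial : ℂ)) *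
    x ^ i.1 * y ^ i.2

/-- Appell's double series; it converges (absolutely) for `‖x‖ < 1`, `‖y‖ < 1`. -/
def appellF3Series (a a' b b' c x y : ℂ) : ℂ :=
  ∑' i : ℕ × ℕ, appellF3Term a a' b b' c x y i

/-- `g` is the analytic continuation of `s ↦ F₃(…; s x, s y)` from a neighbourhood of `s = 0`
along the segment `0 ≤ s ≤ 1`. -/
def IsAppellF3Continuation (a a' b b' c x y : ℂ) (g : ℂ → ℂ) : Prop :=
  AnalyticOnNhd ℂ g (segment ℝ (0 : ℂ) 1) ∧
    ∀ᶠ s in 𝓝 (0 : ℂ), g s = appellF3Series a a' b b' c (s * x) (s * y)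

open Classical in
/-- Appell's function `F₃(a, a', b, b'; c; x, y)`: the principal branch, that is, the analytic
continuation of the double series from the origin to `(x, y)` along the straight segment.
(The value is `0` by convention if there is no such continuation.) -/
def appellF3 (a a' b b' c x y : ℂ) : ℂ :=
  if h : ∃ g, IsAppellF3Continuation a a' b b' c x y g then h.choose 1 else 0

/-- Analytic continuation is unique, so any continuation computes `F₃`. -/
theorem appellF3_eq_of_continuation {a a' b b' c x y : ℂ} {g : ℂ → ℂ}
    (hg : IsAppellF3Continuation a a' b b' c x y g) : appellF3 a a' b b' c x y = g 1 := by
  have h : ∃ g, IsAppellF3Continuation a a' b b' c x y g := ⟨g, hg⟩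
  rw [appellF3, dif_pos h]
  have h1 := h.choose_spec
  refine h1.1.eqOn_of_preconnected_of_eventuallyEq hg.1
    (convex_segment (0 : ℂ) 1).isPreconnected (left_mem_segment ℝ 0 1) ?_
    (right_mem_segment ℝ 0 1)
  filter_upwards [h1.2, hg.2] with s hs hs'
  rw [hs, hs']

/-- The integrand
`(x - t)^(γ-1) t^(-α') F₃(α, α', β, β'; γ; 1 - t/x, 1 - x/t) f(t)`
of the left-sided Marichev–Saigo–Maeda operator. -/
def msmIntegrand (α α' β β' γ : ℂ) (f : ℝ → ℂ) (x t : ℝ) : ℂ :=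
  ((x - t : ℝ) : ℂ) ^ (γ - 1) * (t : ℂ) ^ (-α') *
    appellF3 α α' β β' γ ((1 - t / x : ℝ) : ℂ) ((1 - x / t : ℝ) : ℂ) * f t

/-- The left-sided Marichev–Saigo–Maeda fractional integral `(I_{0,+}^{α,α',β,β',γ} f)(x)`. -/
def msmIntegral (α α' β β' γ : ℂ) (f : ℝ → ℂ) (x : ℝ) : ℂ :=
  (x : ℂ) ^ (-α) / Complex.Gamma γ * ∫ t in (0 : ℝ)..x, msmIntegrand α α' β β' γ f x t

/-- The general term of the generalized Wright function: the entries of `a` and `b` are the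
pairs `(a_i, α_i)` and `(b_j, β_j)`. At a pole of `Γ`, Mathlib's `Γ` is `0`, so that a factor
`1 / Γ` vanishes there, as it should. -/
def wrightTerm {p q : ℕ} (a : Fin p → ℂ × ℝ) (b : Fin q → ℂ × ℝ) (z : ℂ) (k : ℕ) : ℂ :=
  (∏ i, Complex.Gamma ((a i).1 + ((a i).2 : ℂ) * k)) /
    (∏ j, Complex.Gamma ((b j).1 + ((b j).2 : ℂ) * k)) * (z ^ k / (k.factorial : ℂ))

/-- The generalized Wright function `_pψ_q[(a_i, α_i); (b_j, β_j) | z]`. -/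
def wrightPsi {p q : ℕ} (a : Fin p → ℂ × ℝ) (b : Fin q → ℂ × ℝ) (z : ℂ) : ℂ :=
  ∑' k : ℕ, wrightTerm a b z k

end

/-!
The operator acts on a power `t ^ (ρ - 1)` as multiplication by
`x ^ (γ - α - α')` times the quotient of Gamma functions `msmMultiplier α α' β β' γ ρ`
(`msm_power`). The cosine and the hyperbolic cosine are then expanded in power series and integrated
term by term (`msm_power_mul_even`); the duplication identity for `Γ(1/2 + k)` turns the factor
`1 / (2 k)!` into the pair `(1/2, 1)` and the factor `√π` of the Wright series.

*The kernel.* With `u = 1 - t / x` and `v = 1 - x / t` one has `v / (v - 1) = u`. Pfaff's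
transformation of the inner `₂F₁` turns the series of `F₃(…; y, z)` into a double series in
`y` and `z / (z - 1)`, which converges along the whole segment from the origin to `(u, v)`
(`isAppellF3Continuation_pfaff`). Hence `F₃(…; u, v) = (x / t) ^ (-α') ∑ A_{m,n} u ^ (m + n)`
(`appellF3_kernel`), with explicit coefficients `A_{m,n} = f3Coeff …`.

*Powers, when `Re α' > 0`.* Each term gives a Beta integral. The sum over `n` and the sum over `m`
are then evaluated by Gauss's theorem (`tsum_gaussTerm`). Absolute convergence of the double series
of integrals follows from a uniform bound for `(a + m)_n / (c + m)_n` (`exists_norm_poch_div_le`).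

*Powers, in general.* For `Re α' ≤ 0` the double series of integrals need not converge absolutely.
The contiguous relation
`F₃(α'; β'; γ) = F₃(α' + 1; β'; γ) - (β' / γ) v F₃(α' + 1; β' + 1; γ + 1)`
(`appellF3_contiguous`) expresses the image of `t ^ (ρ - 1)` through the images under the operators
with parameters `(α' + 1, β', γ)` and `(α' + 1, β' + 1, γ + 1)` of `t ^ ρ` and `t ^ (ρ - 1)`, and
both of these satisfy the same conditions on the real parts. Induction therefore reduces the claim
to the case `Re α' > 0`.
-/

noncomputable section

/-! ### Pochhammer symbols -/

/-- The Pochhammer symbol `(a)_n = a (a + 1) ⋯ (a + n - 1)`. -/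
def poch (a : ℂ) (n : ℕ) : ℂ := (ascPochhammer ℂ n).eval a

@[simp] lemma poch_zero (a : ℂ) : poch a 0 = 1 := by simp [poch]

lemma poch_succ (a : ℂ) (n : ℕ) : poch a (n + 1) = poch a n * (a + n) := by
  simp [poch, ascPochhammer_succ_eval]

lemma poch_add (a : ℂ) (m n : ℕ) : poch a (m + n) = poch a m * poch (a + m) n := by
  induction n with
  | zero => simp
  | succ n ih => rw [← add_assoc, poch_succ, ih, poch_succ]; push_cast; ring

lemma poch_succ_left (a : ℂ) (n : ℕ) : poch a (n + 1) = a * poch (a + 1) n := by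
  rw [add_comm n 1, poch_add, poch_succ]; simp

lemma poch_one (n : ℕ) : poch 1 n = (n.factorial : ℂ) := by
  simp [poch, ascPochhammer_eval_one]

lemma poch_eq_prod (a : ℂ) (n : ℕ) : poch a n = ∏ j ∈ Finset.range n, (a + j) := by
  induction n with
  | zero => simp
  | succ n ih => rw [poch_succ, ih, Finset.prod_range_succ]

lemma poch_ne_zero {c : ℂ} (hc : 0 < c.re) (n : ℕ) : poch c n ≠ 0 := by
  rw [poch_eq_prod, Finset.prod_ne_zero_iff]
  intro j _ h
  have := congrArg Complex.re h
  simp at this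
  linarith [(Nat.cast_nonneg j : (0:ℝ) ≤ j)]


lemma Gamma_add_nat_eq_poch {c : ℂ} (hc : 0 < c.re) (n : ℕ) :
    Complex.Gamma (c + n) = poch c n * Complex.Gamma c := by
  induction n with
  | zero => simp
  | succ n ih =>
    have h0 : c + n ≠ 0 := by
      intro h
      have := congrArg Complex.re h
      simp at this
      linarith [(Nat.cast_nonneg n : (0:ℝ) ≤ n)]
    rw [Nat.cast_succ, ← add_assoc, Complex.Gamma_add_one _ h0, ih, poch_succ]
    ring

/-- The power `(1 + 1 / (j + 1)) ^ (c - a)` matches the quotient `(a + j) / (c + j)` up to a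
relative error `O(1 / j ^ 2)`: the two Taylor expansions in `1 / (j + 1)` agree to first order. -/
lemma exists_norm_add_div_add_le {a c : ℂ} (hc : 0 < c.re) :
    ∃ A : ℝ, 0 ≤ A ∧ ∀ j : ℕ, ‖(a + j) / (c + j)‖ ≤
      (1 + A * (1 / ((j : ℝ) + 1) ^ 2)) * (((j : ℝ) + 2) / (j + 1)) ^ (a - c).re := by
  set f : ℂ → ℂ := fun z => (1 + (a - 1) * z) / (1 + (c - 1) * z) * (1 + z) ^ (c - a) with hf
  have hfan : AnalyticAt ℂ f 0 := by
    refine AnalyticAt.mul (AnalyticAt.div (by fun_prop) (by fun_prop) (by simp)) ?_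
    exact AnalyticAt.cpow (by fun_prop) (by fun_prop) (by simp)
  have hder : deriv f 0 = 0 := by
    have h1 : HasDerivAt (fun z : ℂ => 1 + (a - 1) * z) (a - 1) 0 := by
      simpa using ((hasDerivAt_id (0 : ℂ)).const_mul (a - 1)).const_add 1
    have h2 : HasDerivAt (fun z : ℂ => 1 + (c - 1) * z) (c - 1) 0 := by
      simpa using ((hasDerivAt_id (0 : ℂ)).const_mul (c - 1)).const_add 1
    have h3 : HasDerivAt (fun z : ℂ => (1 + z) ^ (c - a)) (c - a) 0 := by
      have := ((hasDerivAt_id (0 : ℂ)).const_add 1).cpow_const (c := c - a) (by simp)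
      simpa using this
    have := ((h1.div h2 (by simp)).mul h3).deriv
    simp only [Pi.div_apply] at this
    refine this.trans ?_
    simp
  have hbig : (fun z : ℂ => f z - 1) =O[𝓝 0] fun z => ‖z‖ ^ 2 := by
    obtain ⟨p, hp⟩ := hfan
    have h := hp.isBigO_sub_partialSum_pow 2
    have h0 : p.coeff 0 = 1 := (hp.coeff_zero _).trans (by simp [hf])
    have h1 : p.coeff 1 = 0 := by rw [← hder, hp.deriv]; rfl
    refine h.congr_left fun z => ?_
    simp [FormalMultilinearSeries.partialSum, Finset.sum_range_succ, h0, h1]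
  have hlim : Tendsto (fun j : ℕ => (1 / ((j : ℂ) + 1))) atTop (𝓝 0) :=
    tendsto_one_div_add_atTop_nhds_zero_nat
  have hseq := hbig.comp_tendsto hlim
  rw [Asymptotics.isBigO_nat_atTop_iff] at hseq
  · obtain ⟨A, hA⟩ := hseq
    refine ⟨max A 0, le_max_right _ _, fun j => ?_⟩
    have hj := hA j
    have hj1 : (0 : ℝ) < j + 1 := by positivity
    have hj1' : (j : ℂ) + 1 ≠ 0 := by exact_mod_cast hj1.ne'
    have hn : ‖(1 / ((j : ℂ) + 1))‖ ^ 2 = 1 / ((j : ℝ) + 1) ^ 2 := by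
      have : (1 / ((j : ℂ) + 1)) = ((1 / ((j : ℝ) + 1) : ℝ) : ℂ) := by push_cast; rfl
      rw [this, Complex.norm_real, Real.norm_of_nonneg (by positivity)]
      simp
    simp only [Function.comp, hn, Real.norm_eq_abs] at hj
    have hcj : c + j ≠ 0 := by
      intro h
      have := congrArg Complex.re h
      simp at this
      linarith [(Nat.cast_nonneg j : (0:ℝ) ≤ j)]
    have hval : f (1 / ((j : ℂ) + 1)) =
        (a + j) / (c + j) * (((((j : ℝ) + 2) / (j + 1) : ℝ)) : ℂ) ^ (c - a) := by
      have e1 : 1 + (a - 1) * (1 / ((j : ℂ) + 1)) = (a + j) / (j + 1) := by field_simp; ring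
      have e2 : 1 + (c - 1) * (1 / ((j : ℂ) + 1)) = (c + j) / (j + 1) := by field_simp; ring
      have e3 : 1 + (1 / ((j : ℂ) + 1)) = ((((j : ℝ) + 2) / (j + 1) : ℝ) : ℂ) := by
        push_cast; field_simp; ring
      simp only [hf]
      rw [e1, e2, e3]
      congr 1
      field_simp
    have hpos : (0 : ℝ) < ((j : ℝ) + 2) / (j + 1) := by positivity
    have hnorm : ‖f (1 / ((j : ℂ) + 1))‖ =
        ‖(a + j) / (c + j)‖ * (((j : ℝ) + 2) / (j + 1)) ^ (-(a - c).re) := by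
      rw [hval, norm_mul, Complex.norm_cpow_eq_rpow_re_of_pos hpos]
      congr 2
      simp
    have hle : ‖f (1 / ((j : ℂ) + 1))‖ ≤ 1 + max A 0 * (1 / ((j : ℝ) + 1) ^ 2) := by
      have h1 : ‖f (1 / ((j : ℂ) + 1))‖ ≤ ‖f (1 / ((j : ℂ) + 1)) - 1‖ + 1 := by
        simpa using norm_add_le (f (1 / ((j : ℂ) + 1)) - 1) 1
      have h2 : A * |1 / ((j : ℝ) + 1) ^ 2| ≤ max A 0 * (1 / ((j : ℝ) + 1) ^ 2) := by
        rw [abs_of_nonneg (by positivity)]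
        gcongr
        exact le_max_left _ _
      linarith
    rw [hnorm, Real.rpow_neg hpos.le] at hle
    rwa [← div_eq_mul_inv, div_le_iff₀ (by positivity)] at hle
  · intro j hj
    exfalso
    have : (j : ℂ) + 1 ≠ 0 := by exact_mod_cast (Nat.succ_ne_zero j)
    simp [this] at hj

/-- Uniform power bound for quotients of Pochhammer symbols. -/
lemma exists_norm_poch_div_le (a : ℂ) {c : ℂ} (hc : 0 < c.re) :
    ∃ C : ℝ, 0 < C ∧ ∀ m n : ℕ, ‖poch (a + m) n / poch (c + m) n‖ ≤
      C * (((m : ℝ) + n + 1) / (m + 1)) ^ (a - c).re := by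
  obtain ⟨A, hA0, hA⟩ := exists_norm_add_div_add_le (a := a) hc
  have hs : Summable fun j : ℕ => A * (1 / ((j : ℝ) + 1) ^ 2) := by
    have := (summable_nat_add_iff 1).2 (Real.summable_one_div_nat_pow.2 one_lt_two)
    simpa using this.mul_left A
  refine ⟨Real.exp (∑' j : ℕ, A * (1 / ((j : ℝ) + 1) ^ 2)), Real.exp_pos _, fun m n => ?_⟩
  have key : ‖poch (a + m) n / poch (c + m) n‖ ≤
      Real.exp (∑ j ∈ Finset.range n, A * (1 / (((m + j : ℕ) : ℝ) + 1) ^ 2)) *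
        (((m : ℝ) + n + 1) / (m + 1)) ^ (a - c).re := by
    induction n with
    | zero => simp [div_self (show (m : ℝ) + 1 ≠ 0 by positivity)]
    | succ n ih =>
      rw [poch_succ, poch_succ, mul_div_mul_comm, norm_mul, Finset.sum_range_succ, Real.exp_add]
      have h := hA (m + n)
      have h2 : (1 + A * (1 / (((m + n : ℕ) : ℝ) + 1) ^ 2)) ≤
          Real.exp (A * (1 / (((m + n : ℕ) : ℝ) + 1) ^ 2)) := by
        rw [add_comm]; exact Real.add_one_le_exp _
      have h3 : (((m : ℝ) + (n + 1 : ℕ) + 1) / (m + 1)) ^ (a - c).re =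
          (((m : ℝ) + n + 1) / (m + 1)) ^ (a - c).re *
            ((((m + n : ℕ) : ℝ) + 2) / (((m + n : ℕ) : ℝ) + 1)) ^ (a - c).re := by
        rw [← Real.mul_rpow (by positivity) (by positivity)]
        congr 1
        push_cast
        field_simp
        ring
      have h4 : ‖(a + m + n) / (c + m + n)‖ ≤
          Real.exp (A * (1 / (((m + n : ℕ) : ℝ) + 1) ^ 2)) *
            ((((m + n : ℕ) : ℝ) + 2) / (((m + n : ℕ) : ℝ) + 1)) ^ (a - c).re := by
        have : (a + m + n) / (c + m + n) = (a + (m + n : ℕ)) / (c + (m + n : ℕ)) := by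
          push_cast; rw [add_assoc, add_assoc]
        rw [this]
        exact h.trans (by gcongr)
      rw [h3]
      calc _ ≤ _ := mul_le_mul ih h4 (norm_nonneg _) (by positivity)
        _ = _ := by ring
  refine key.trans ?_
  gcongr
  have := (hs.sum_le_tsum (Finset.image (fun j => m + j) (Finset.range n))
    (fun j _ => by positivity))
  rwa [Finset.sum_image (by intro i _ j _ h; simpa using h)] at this

/-- The case `m = 0` of `exists_norm_poch_div_le`. -/
lemma exists_norm_poch_div_le_rpow (a : ℂ) {c : ℂ} (hc : 0 < c.re) :
    ∃ C : ℝ, 0 < C ∧ ∀ n : ℕ, ‖poch a n / poch c n‖ ≤ C * ((n : ℝ) + 1) ^ (a - c).re := by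
  obtain ⟨C, hC, h⟩ := exists_norm_poch_div_le a hc
  exact ⟨C, hC, fun n => by simpa using h 0 n⟩

lemma exists_norm_poch_div_factorial_le (a : ℂ) :
    ∃ C : ℝ, 0 < C ∧ ∀ n : ℕ, ‖poch a n / (n.factorial : ℂ)‖ ≤ C * ((n : ℝ) + 1) ^ (a.re - 1) := by
  simpa [poch_one] using exists_norm_poch_div_le_rpow a (c := 1) (by simp)

/-! ### Gauss's summation theorem -/

/-- The general term `(a)_n (b)_n / (n! Γ(c + n))` of the regularized hypergeometric series at
the point `1`. -/
def gaussTerm (a b c : ℂ) (n : ℕ) : ℂ :=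
  poch a n * poch b n / (n.factorial : ℂ) * (Complex.Gamma (c + n))⁻¹

lemma gaussTerm_eq_mul (a b c : ℂ) (n : ℕ) :
    gaussTerm a b c n = (c + n) * gaussTerm a b (c + 1) n := by
  have := Complex.one_div_Gamma_eq_self_mul_one_div_Gamma_add_one (c + n)
  rw [gaussTerm, gaussTerm, this, add_right_comm c 1 (n : ℂ)]
  ring

lemma gaussTerm_of_re_pos (a b : ℂ) {c : ℂ} (hc : 0 < c.re) (n : ℕ) :
    gaussTerm a b c n =
      (poch a n / (n.factorial : ℂ)) * (poch b n / poch c n) * (Complex.Gamma c)⁻¹ := by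
  rw [gaussTerm, Gamma_add_nat_eq_poch hc, mul_inv]
  ring

/-- The bound holds for every `c`, since it passes from `c + 1` to `c`. -/
lemma exists_norm_gaussTerm_le (a b c : ℂ) :
    ∃ C : ℝ, 0 < C ∧ ∀ n : ℕ, ‖gaussTerm a b c n‖ ≤ C * ((n : ℝ) + 1) ^ ((a + b - c).re - 1) := by
  obtain ⟨K, hK⟩ : ∃ K : ℕ, 0 < c.re + K := by
    obtain ⟨K, hK⟩ := exists_nat_gt (-c.re)
    exact ⟨K, by linarith⟩
  induction K generalizing c with
  | zero =>
    have hc : 0 < c.re := by simpa using hK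
    obtain ⟨C₁, h₁, H₁⟩ := exists_norm_poch_div_factorial_le a
    obtain ⟨C₂, h₂, H₂⟩ := exists_norm_poch_div_le_rpow b hc
    have hG : 0 < ‖(Complex.Gamma c)⁻¹‖ :=
      norm_pos_iff.2 (inv_ne_zero (Complex.Gamma_ne_zero_of_re_pos hc))
    refine ⟨C₁ * C₂ * ‖(Complex.Gamma c)⁻¹‖, by positivity, fun n => ?_⟩
    rw [gaussTerm_of_re_pos a b hc, norm_mul, norm_mul]
    have : (a + b - c).re - 1 = (a.re - 1) + (b - c).re := by simp; ring
    rw [this, Real.rpow_add (by positivity)]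
    calc _ ≤ (C₁ * ((n : ℝ) + 1) ^ (a.re - 1)) * (C₂ * ((n : ℝ) + 1) ^ (b - c).re) *
          ‖(Complex.Gamma c)⁻¹‖ := by gcongr; exacts [H₁ n, H₂ n]
      _ = _ := by ring
  | succ K ih =>
    obtain ⟨C, h, H⟩ := ih (c + 1) (by simp at hK ⊢; linarith)
    refine ⟨(‖c‖ + 1) * C, by positivity, fun n => ?_⟩
    have hn : ‖c + n‖ ≤ (‖c‖ + 1) * ((n : ℝ) + 1) := by
      have := norm_add_le c (n : ℂ)
      rw [Complex.norm_natCast] at this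
      nlinarith [norm_nonneg c, (Nat.cast_nonneg n : (0 : ℝ) ≤ n)]
    have e : (a + b - c).re - 1 = 1 + ((a + b - (c + 1)).re - 1) := by simp; ring
    rw [gaussTerm_eq_mul, norm_mul, e, Real.rpow_add (by positivity), Real.rpow_one]
    calc _ ≤ (‖c‖ + 1) * ((n : ℝ) + 1) * (C * ((n : ℝ) + 1) ^ ((a + b - (c + 1)).re - 1)) := by
          gcongr; exact H n
      _ = _ := by ring

lemma summable_nat_add_one_rpow {p : ℝ} (hp : p < -1) :
    Summable fun n : ℕ => ((n : ℝ) + 1) ^ p := by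
  simpa using (summable_nat_add_iff 1).2 (Real.summable_nat_rpow.2 hp)

lemma summable_gaussTerm {a b c : ℂ} (h : 0 < (c - a - b).re) : Summable (gaussTerm a b c) := by
  obtain ⟨C, -, H⟩ := exists_norm_gaussTerm_le a b c
  refine Summable.of_norm_bounded ((summable_nat_add_one_rpow ?_).mul_left C) H
  simp at h ⊢
  linarith

/-- The relation between the values at `c` and `c + 1`; the difference of the two sides is a
telescoping series. -/
lemma tsum_gaussTerm_add_one {a b c : ℂ} (h : 0 < (c - a - b).re) :
    (c - a - b) * ∑' n, gaussTerm a b c n =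
      (c - a) * (c - b) * ∑' n, gaussTerm a b (c + 1) n := by
  set G : ℕ → ℂ := fun n => n * gaussTerm a b c n with hG
  have hdiff : ∀ n, G (n + 1) - G n =
      (c - a) * (c - b) * gaussTerm a b (c + 1) n - (c - a - b) * gaussTerm a b c n := by
    intro n
    have h1 : G (n + 1) = (a + n) * (b + n) * gaussTerm a b (c + 1) n := by
      have : (n.factorial : ℂ) ≠ 0 := by exact_mod_cast n.factorial_ne_zero
      have h' : (n : ℂ) + 1 ≠ 0 := by exact_mod_cast n.succ_ne_zero
      simp only [hG, gaussTerm, poch_succ, Nat.factorial_succ, Nat.cast_mul, Nat.cast_succ]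
      rw [show c + ((n : ℂ) + 1) = c + 1 + n by ring]
      field_simp
    rw [h1]
    simp only [hG]
    rw [gaussTerm_eq_mul a b c n]
    ring
  have hlim : Tendsto G atTop (𝓝 0) := by
    obtain ⟨C, hC, H⟩ := exists_norm_gaussTerm_le a b c
    have hz : Tendsto (fun n : ℕ => C * ((n : ℝ) + 1) ^ (-((c - a - b).re))) atTop (𝓝 0) := by
      have h1 : Tendsto (fun n : ℕ => (n : ℝ) + 1) atTop atTop :=
        tendsto_atTop_add_const_right _ _ tendsto_natCast_atTop_atTop
      simpa using ((tendsto_rpow_neg_atTop h).comp h1).const_mul C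
    refine squeeze_zero_norm (fun n => ?_) hz
    simp only [hG, norm_mul, Complex.norm_natCast]
    have e : -((c - a - b).re) = 1 + ((a + b - c).re - 1) := by simp; ring
    rw [e, Real.rpow_add (by positivity), Real.rpow_one]
    calc _ ≤ ((n : ℝ) + 1) * (C * ((n : ℝ) + 1) ^ ((a + b - c).re - 1)) := by
          gcongr
          · linarith
          · exact H n
      _ = _ := by ring
  have hs1 := summable_gaussTerm h
  have hs2 : Summable (gaussTerm a b (c + 1)) :=
    summable_gaussTerm (by simp at h ⊢; linarith)
  have hsum := (hs2.hasSum.mul_left ((c - a) * (c - b))).sub (hs1.hasSum.mul_left (c - a - b))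
  have htel : Tendsto (fun N => ∑ n ∈ Finset.range N, (G (n + 1) - G n)) atTop (𝓝 0) := by
    simp_rw [Finset.sum_range_sub]
    simpa [hG] using hlim
  simp_rw [hdiff] at htel
  have := tendsto_nhds_unique hsum.tendsto_sum_nat htel
  exact (sub_eq_zero.1 this).symm

lemma poch_mul_tsum_gaussTerm {a b c : ℂ} (h : 0 < (c - a - b).re) (N : ℕ) :
    poch (c - a - b) N * ∑' n, gaussTerm a b c n =
      poch (c - a) N * poch (c - b) N * ∑' n, gaussTerm a b (c + N) n := by
  induction N with
  | zero => simp
  | succ N ih =>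
    have := tsum_gaussTerm_add_one (a := a) (b := b) (c := c + N)
      (by simp at h ⊢; linarith [(Nat.cast_nonneg N : (0 : ℝ) ≤ N)])
    rw [poch_succ, poch_succ, poch_succ, mul_right_comm, ih, Nat.cast_succ, ← add_assoc]
    linear_combination (poch (c - a) N * poch (c - b) N) * this

lemma norm_poch_le_norm_poch_add {c : ℂ} (hc : 0 < c.re) (m n : ℕ) :
    ‖poch c n‖ ≤ ‖poch (c + m) n‖ := by
  rw [poch_eq_prod, poch_eq_prod, norm_prod, norm_prod]
  refine Finset.prod_le_prod (fun _ _ => norm_nonneg _) fun j _ => ?_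
  rw [← sq_le_sq₀ (norm_nonneg _) (norm_nonneg _), ← Complex.normSq_eq_norm_sq,
    ← Complex.normSq_eq_norm_sq, Complex.normSq_apply, Complex.normSq_apply]
  have hm : (0 : ℝ) ≤ m := Nat.cast_nonneg m
  have hj : (0 : ℝ) ≤ j := Nat.cast_nonneg j
  simp
  nlinarith

/-- The hypergeometric series `₂F₁(a, b; c + N; 1)` tends to its term with `n = 0`. -/
lemma tendsto_Gamma_mul_tsum_gaussTerm {a b c : ℂ} (hc : 0 < c.re) (h : 0 < (c - a - b).re) :
    Tendsto (fun N : ℕ => Complex.Gamma (c + N) * ∑' n, gaussTerm a b (c + N) n) atTop (𝓝 1) := by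
  have hcN : ∀ N : ℕ, 0 < (c + N).re := fun N => by simp; positivity
  have hval : ∀ N n : ℕ, Complex.Gamma (c + N) * gaussTerm a b (c + N) n =
      (poch a n / (n.factorial : ℂ)) * (poch b n / poch (c + N) n) := by
    intro N n
    rw [gaussTerm_of_re_pos a b (hcN N)]
    have := Complex.Gamma_ne_zero_of_re_pos (hcN N)
    field_simp
  simp_rw [← tsum_mul_left, hval]
  have h1 : (1 : ℂ) = ∑' n : ℕ, if n = 0 then 1 else 0 := by simp
  rw [h1]
  refine tendsto_tsum_of_dominated_convergence
    (bound := fun n => ‖(poch a n / (n.factorial : ℂ)) * (poch b n / poch c n)‖) ?_ ?_ ?_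
  · have hs := ((summable_gaussTerm h).mul_left (Complex.Gamma c)).norm
    have := hval 0
    simp only [Nat.cast_zero, add_zero] at this
    simpa only [this] using hs
  · intro n
    rcases Nat.eq_zero_or_pos n with rfl | hn
    · simp
    · simp only [hn.ne', if_false]
      obtain ⟨k, rfl⟩ : ∃ k, n = k + 1 := ⟨n - 1, by omega⟩
      have hinv : Tendsto (fun N : ℕ => (c + (N : ℂ))⁻¹) atTop (𝓝 0) := by
        refine tendsto_inv₀_cobounded.comp ?_
        refine (tendsto_const_add_cobounded c).comp ?_
        exact tendsto_natCast_atTop_cobounded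
      refine squeeze_zero_norm (a := fun N : ℕ => ‖(c + (N : ℂ))⁻¹‖ *
        (‖poch a (k + 1) / ((k + 1).factorial : ℂ)‖ * (‖poch b (k + 1)‖ / ‖poch (c + 1) k‖)))
        (fun N => ?_) (by simpa using hinv.norm.mul_const _)
      rw [poch_succ_left (c + N), norm_mul, norm_div (poch b (k + 1)), norm_mul, norm_inv]
      have h2 := norm_poch_le_norm_poch_add (c := c + 1) (by simp; positivity) N k
      rw [add_right_comm] at h2
      have h3 : 0 < ‖poch (c + 1) k‖ := norm_pos_iff.2 (poch_ne_zero (by simp; positivity) k)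
      calc _ ≤ ‖poch a (k + 1) / ((k + 1).factorial : ℂ)‖ *
            (‖poch b (k + 1)‖ / (‖c + N‖ * ‖poch (c + 1) k‖)) := by
            have := norm_pos_iff.2 (show c + (N : ℂ) ≠ 0 from
              fun h0 => by simpa [h0] using hcN N)
            gcongr
        _ = _ := by rw [← div_div, div_right_comm, div_eq_inv_mul (_ / _)]; ring
  · refine Eventually.of_forall fun N n => ?_
    rw [norm_mul, norm_mul, norm_div (poch b n), norm_div (poch b n)]
    have h3 : 0 < ‖poch c n‖ := norm_pos_iff.2 (poch_ne_zero hc n)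
    gcongr
    exact norm_poch_le_norm_poch_add hc N n

/-- At a pole of `Γ` both sides are the inverse of the value `0`, which is the value of the entire
function `1 / Γ`. -/
lemma tendsto_inv_GammaSeq (s : ℂ) :
    Tendsto (fun n => (Complex.GammaSeq s n)⁻¹) atTop (𝓝 (Complex.Gamma s)⁻¹) := by
  by_cases hs : Complex.Gamma s = 0
  · obtain ⟨k, rfl⟩ := (Complex.Gamma_eq_zero_iff s).1 hs
    rw [hs]
    refine tendsto_const_nhds.congr' ?_
    filter_upwards [eventually_ge_atTop k] with n hn
    rw [Complex.GammaSeq, Finset.prod_eq_zero (Finset.mem_range.2 (Nat.lt_succ_of_le hn)) (by simp)]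
    simp
  · exact (Complex.GammaSeq_tendsto_Gamma s).inv₀ hs

lemma poch_succ_eq_GammaSeq_inv (s : ℂ) {n : ℕ} (hn : n ≠ 0) :
    poch s (n + 1) = (n : ℂ) ^ s * (n.factorial : ℂ) * (Complex.GammaSeq s n)⁻¹ := by
  have h1 : (n : ℂ) ^ s ≠ 0 := by simp [Complex.cpow_eq_zero_iff, hn]
  have h2 : (n.factorial : ℂ) ≠ 0 := by exact_mod_cast n.factorial_ne_zero
  rw [Complex.GammaSeq, ← poch_eq_prod, inv_div, mul_div_cancel₀]
  exact mul_ne_zero h1 h2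

/-- Gauss's theorem `∑ (a)_n (b)_n / (n! Γ(c + n)) = Γ(c - a - b) / (Γ(c - a) Γ(c - b))`.
For `Re c > 0` the relation between `c` and `c + 1` is iterated to `c + N` and `N → ∞`; the other
values of `c`, including the poles of `Γ`, follow by stepping down from `c + 1` to `c`. -/
theorem tsum_gaussTerm {a b c : ℂ} (h : 0 < (c - a - b).re) :
    ∑' n, gaussTerm a b c n =
      Complex.Gamma (c - a - b) * (Complex.Gamma (c - a))⁻¹ * (Complex.Gamma (c - b))⁻¹ := by
  obtain ⟨K, hK⟩ : ∃ K : ℕ, 0 < c.re + K := by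
    obtain ⟨K, hK⟩ := exists_nat_gt (-c.re)
    exact ⟨K, by linarith⟩
  induction K generalizing c with
  | zero =>
    have hc : 0 < c.re := by simpa using hK
    have hΓc := Complex.Gamma_ne_zero_of_re_pos hc
    set S := ∑' n, gaussTerm a b c n with hS
    -- All powers of `N` and factorials in the Pochhammer symbols cancel, as
    -- `(c - a - b) + c = (c - a) + (c - b)`.
    have hconst : ∀ N : ℕ, N ≠ 0 → Complex.Gamma c * S =
        Complex.GammaSeq (c - a - b) N * Complex.GammaSeq c N *
          (Complex.GammaSeq (c - a) N)⁻¹ * (Complex.GammaSeq (c - b) N)⁻¹ *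
          (Complex.Gamma (c + (N + 1 : ℕ)) * ∑' n, gaussTerm a b (c + (N + 1 : ℕ)) n) := by
      intro N hN
      have h1 := poch_mul_tsum_gaussTerm h (N + 1)
      rw [Gamma_add_nat_eq_poch hc]
      have p1 := poch_ne_zero h (N + 1)
      have p2 := poch_ne_zero hc (N + 1)
      have e1 := poch_succ_eq_GammaSeq_inv (c - a - b) hN
      have e2 := poch_succ_eq_GammaSeq_inv c hN
      have e3 := poch_succ_eq_GammaSeq_inv (c - a) hN
      have e4 := poch_succ_eq_GammaSeq_inv (c - b) hN
      have hNC : (N : ℂ) ≠ 0 := by exact_mod_cast hN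
      have hpow : (N : ℂ) ^ (c - a - b) * (N : ℂ) ^ c = (N : ℂ) ^ (c - a) * (N : ℂ) ^ (c - b) := by
        rw [← Complex.cpow_add _ _ hNC, ← Complex.cpow_add _ _ hNC]
        congr 1
        ring
      have q1 : Complex.GammaSeq (c - a - b) N ≠ 0 := by
        intro h0; rw [h0] at e1; simp at e1; exact p1 e1
      have q2 : Complex.GammaSeq c N ≠ 0 := by
        intro h0; rw [h0] at e2; simp at e2; exact p2 e2
      have hf : (N.factorial : ℂ) ≠ 0 := by exact_mod_cast N.factorial_ne_zero
      have hn1 : (N : ℂ) ^ (c - a - b) ≠ 0 := by simp [Complex.cpow_eq_zero_iff, hN]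
      rw [e1, e3, e4] at h1
      rw [e2]
      have h2 : (N : ℂ) ^ (c - a - b) * S = (N : ℂ) ^ (c - a) * (N : ℂ) ^ (c - b) *
          (N.factorial : ℂ) * Complex.GammaSeq (c - a - b) N *
          (Complex.GammaSeq (c - a) N)⁻¹ * (Complex.GammaSeq (c - b) N)⁻¹ *
          ∑' n, gaussTerm a b (c + (N + 1 : ℕ)) n := by
        have h3 := congrArg
          (fun z => z * Complex.GammaSeq (c - a - b) N * (N.factorial : ℂ)⁻¹) h1
        rw [show (N : ℂ) ^ (c - a - b) * S = ((N : ℂ) ^ (c - a - b) * (N.factorial : ℂ) *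
          (Complex.GammaSeq (c - a - b) N)⁻¹ * S) * Complex.GammaSeq (c - a - b) N *
          (N.factorial : ℂ)⁻¹ by field_simp, h3]
        field_simp
      rw [← hpow] at h2
      apply mul_left_cancel₀ hn1
      linear_combination Complex.Gamma c * h2 -
        Complex.Gamma c * (N : ℂ) ^ (c - a - b) * (N : ℂ) ^ c *
          (N.factorial : ℂ) * Complex.GammaSeq (c - a - b) N *
          (Complex.GammaSeq (c - a) N)⁻¹ * (Complex.GammaSeq (c - b) N)⁻¹ *
          (∑' n, gaussTerm a b (c + (N + 1 : ℕ)) n) * mul_inv_cancel₀ q2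
    have hlim := ((((Complex.GammaSeq_tendsto_Gamma (c - a - b)).mul
      (Complex.GammaSeq_tendsto_Gamma c)).mul (tendsto_inv_GammaSeq (c - a))).mul
      (tendsto_inv_GammaSeq (c - b))).mul
      ((tendsto_Gamma_mul_tsum_gaussTerm hc h).comp (tendsto_add_atTop_nat 1))
    have hev : Tendsto (fun _ : ℕ => Complex.Gamma c * S) atTop
        (𝓝 (Complex.Gamma (c - a - b) * Complex.Gamma c * (Complex.Gamma (c - a))⁻¹ *
          (Complex.Gamma (c - b))⁻¹ * 1)) := by
      refine hlim.congr' ?_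
      filter_upwards [eventually_ne_atTop 0] with N hN
      exact (hconst N hN).symm
    have := tendsto_nhds_unique tendsto_const_nhds hev
    apply mul_left_cancel₀ hΓc
    rw [this]
    ring
  | succ K ih =>
    have h0 : c - a - b ≠ 0 := fun h0 => by simp [h0] at h
    have h1 := ih (c := c + 1) (by simp at h ⊢; linarith) (by simp at hK ⊢; linarith)
    have h2 := tsum_gaussTerm_add_one h
    have e1 := Complex.one_div_Gamma_eq_self_mul_one_div_Gamma_add_one (c - a)
    have e2 := Complex.one_div_Gamma_eq_self_mul_one_div_Gamma_add_one (c - b)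
    have e3 := Complex.Gamma_add_one _ h0
    rw [show c + 1 - a - b = c - a - b + 1 by ring, show c + 1 - a = c - a + 1 by ring,
      show c + 1 - b = c - b + 1 by ring, e3] at h1
    apply mul_left_cancel₀ h0
    rw [h2, h1, e1, e2]
    ring

/-! ### Pfaff's transformation -/

lemma tsum_prod_eq_tsum_sum_antidiagonal {f : ℕ × ℕ → ℂ} (hf : Summable f) :
    ∑' p, f p = ∑' N, ∑ p ∈ Finset.HasAntidiagonal.antidiagonal N, f p := by
  have hs := Finset.HasAntidiagonal.sigmaAntidiagonalEquivProd.summable_iff.2 hf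
  refine (Finset.HasAntidiagonal.sigmaAntidiagonalEquivProd.tsum_eq f).symm.trans
    ((hs.tsum_sigma' fun n => (hasSum_fintype _).summable).trans (tsum_congr fun n => ?_))
  rw [tsum_fintype, ← Finset.sum_coe_sort (Finset.HasAntidiagonal.antidiagonal n)]
  rfl

/-- The Chu–Vandermonde identity. -/
lemma sum_choose_mul_poch (c d : ℂ) (N : ℕ) :
    ∑ n ∈ Finset.range (N + 1),
      (-1) ^ n * (N.choose n : ℂ) * poch d n * poch (c + n) (N - n) = poch (c - d) N := by
  induction N generalizing c d with
  | zero => simp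
  | succ N ih =>
    have h1 : ∑ n ∈ Finset.range (N + 2),
        (-1) ^ n * ((N + 1).choose n : ℂ) * poch d n * poch (c + n) (N + 1 - n) =
        (c + N) * (∑ n ∈ Finset.range (N + 1),
          (-1) ^ n * (N.choose n : ℂ) * poch d n * poch (c + n) (N - n)) -
        d * (∑ n ∈ Finset.range (N + 1),
          (-1) ^ n * (N.choose n : ℂ) * poch (d + 1) n * poch (c + 1 + n) (N - n)) := by
      have hA : (c + N) * (∑ n ∈ Finset.range (N + 1),
          (-1) ^ n * (N.choose n : ℂ) * poch d n * poch (c + n) (N - n)) =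
          ∑ n ∈ Finset.range (N + 2),
            (-1) ^ n * (N.choose n : ℂ) * poch d n * poch (c + n) (N + 1 - n) := by
        rw [Finset.sum_range_succ _ (N + 1), Finset.mul_sum]
        simp only [Nat.choose_succ_self, Nat.cast_zero, mul_zero, zero_mul, add_zero]
        refine Finset.sum_congr rfl fun n hn => ?_
        have hn' : n ≤ N := Nat.lt_succ_iff.1 (Finset.mem_range.1 hn)
        rw [Nat.sub_add_comm hn', poch_succ, Nat.cast_sub hn']
        ring
      have hB : d * (∑ n ∈ Finset.range (N + 1),
          (-1) ^ n * (N.choose n : ℂ) * poch (d + 1) n * poch (c + 1 + n) (N - n)) =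
          - ∑ n ∈ Finset.range (N + 1),
            (-1) ^ (n + 1) * (N.choose n : ℂ) * poch d (n + 1) *
              poch (c + (n + 1 : ℕ)) (N + 1 - (n + 1)) := by
        rw [Finset.mul_sum, ← Finset.sum_neg_distrib]
        refine Finset.sum_congr rfl fun n _ => ?_
        rw [poch_succ_left, Nat.succ_sub_succ, Nat.cast_succ,
          show c + 1 + (n : ℂ) = c + (n + 1) by ring]
        ring
      rw [hA, hB, sub_neg_eq_add, Finset.sum_range_succ' _ (N + 1), Finset.sum_range_succ' _ (N + 1),
        add_right_comm, ← Finset.sum_add_distrib]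
      simp only [Nat.choose_zero_right]
      congr 1
      refine Finset.sum_congr rfl fun n _ => ?_
      rw [Nat.choose_succ_succ]
      push_cast
      ring
    rw [h1, ih, ih, poch_succ, show c + 1 - (d + 1) = c - d by ring]
    ring

lemma summable_rpow_mul_geometric (e : ℝ) {r : ℝ} (hr0 : 0 ≤ r) (hr : r < 1) :
    Summable fun n : ℕ => ((n : ℝ) + 1) ^ e * r ^ n := by
  obtain ⟨k, hk⟩ := exists_nat_ge e
  have h1 : Summable fun n : ℕ => (((n + 1 : ℕ) : ℝ)) ^ k * r ^ (n + 1) :=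
    (summable_nat_add_iff (f := fun n : ℕ => (n : ℝ) ^ k * r ^ n) 1).2
      (summable_pow_mul_geometric_of_norm_lt_one k (by rwa [Real.norm_of_nonneg hr0]))
  rcases hr0.eq_or_lt with rfl | hr0
  · refine summable_of_ne_finset_zero (s := {0}) fun n hn => ?_
    rw [zero_pow (by simpa using hn), mul_zero]
  · refine Summable.of_nonneg_of_le (fun n => by positivity) (fun n => ?_) (h1.mul_left r⁻¹)
    have : ((n : ℝ) + 1) ^ e ≤ ((n : ℝ) + 1) ^ k := by
      rw [← Real.rpow_natCast]
      exact Real.rpow_le_rpow_of_exponent_le (by linarith [(Nat.cast_nonneg n : (0 : ℝ) ≤ n)]) hk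
    calc _ ≤ ((n : ℝ) + 1) ^ k * r ^ n := by gcongr
      _ = _ := by rw [pow_succ]; push_cast; field_simp

/-- The binomial series. -/
lemma hasSum_poch_div_factorial (a : ℂ) {y : ℂ} (hy : ‖y‖ < 1) :
    HasSum (fun k : ℕ => poch a k / (k.factorial : ℂ) * y ^ k) ((1 - y) ^ (-a)) := by
  have h := (Complex.one_div_one_sub_cpow_hasFPowerSeriesOnBall_zero a).hasSum (y := y)
    (by rw [← ENNReal.ofReal_one, Metric.eball_ofReal]; simpa using hy)
  rw [zero_add, one_div, ← Complex.cpow_neg] at h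
  refine h.congr_fun fun k => ?_
  have : (k.factorial : ℂ) ≠ 0 := by exact_mod_cast k.factorial_ne_zero
  rw [FormalMultilinearSeries.ofScalars_apply_eq, Ring.choose]
  have h2 := Ring.factorial_nsmul_multichoose_eq_ascPochhammer a k
  rw [← Polynomial.ascPochhammer_smeval_cast ℂ, ← Polynomial.eval_eq_smeval,
    nsmul_eq_mul] at h2
  rw [poch, ← h2, show a + k - 1 - k + 1 = a by ring, smul_eq_mul, mul_div_cancel_left₀ _ this]

/-- Pfaff's transformation of the hypergeometric function `₂F₁(a, b; c; y)`. -/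
lemma tsum_hypergeometric_eq_pfaff (a b : ℂ) {c y : ℂ} (hc : 0 < c.re) (hy : ‖y‖ < 1 / 2) :
    ∑' n : ℕ, poch a n * poch b n / (poch c n * (n.factorial : ℂ)) * y ^ n =
      (1 - y) ^ (-a) * ∑' n : ℕ, poch a n * poch (c - b) n / (poch c n * (n.factorial : ℂ)) *
        (y / (y - 1)) ^ n := by
  have hy1 : ‖y‖ < 1 := by linarith
  have h1y : 1 - y ≠ 0 := by
    intro h
    rw [← sub_eq_zero.1 h, norm_one] at hy1
    exact lt_irrefl _ hy1
  -- Expanding each `(1 - y) ^ (-a - n)` gives the double series `f`; its diagonals are summed by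
  -- the Chu–Vandermonde identity.
  set f : ℕ × ℕ → ℂ := fun p => poch (c - b) p.1 / poch c p.1 * (-1) ^ p.1 *
    (poch a (p.1 + p.2) / ((p.1.factorial : ℂ) * (p.2.factorial : ℂ))) * y ^ (p.1 + p.2) with hf
  have hfs : Summable f := by
    obtain ⟨C₁, hC₁, H₁⟩ := exists_norm_poch_div_le_rpow (c - b) hc
    obtain ⟨C₂, hC₂, H₂⟩ := exists_norm_poch_div_factorial_le a
    set e₁ := max 0 (c - b - c).re
    set e₂ := max 0 (a.re - 1)
    have hr : 2 * ‖y‖ < 1 := by linarith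
    have hs := (summable_rpow_mul_geometric (e₁ + e₂) (by positivity) hr).mul_of_nonneg
      (summable_rpow_mul_geometric e₂ (by positivity) hr) (fun _ => by positivity)
      (fun _ => by positivity)
    refine Summable.of_norm_bounded (hs.mul_left (C₁ * C₂)) fun ⟨n, k⟩ => ?_
    have hn : (0 : ℝ) ≤ n := Nat.cast_nonneg n
    have hk : (0 : ℝ) ≤ k := Nat.cast_nonneg k
    have b1 : ‖poch (c - b) n / poch c n‖ ≤ C₁ * ((n : ℝ) + 1) ^ e₁ := (H₁ n).trans (by
      gcongr
      · linarith
      · exact le_max_right _ _)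
    have b2 : ‖poch a (n + k) / ((n.factorial : ℂ) * (k.factorial : ℂ))‖ ≤
        C₂ * (((n : ℝ) + 1) ^ e₂ * ((k : ℝ) + 1) ^ e₂) * 2 ^ (n + k) := by
      have hfac : poch a (n + k) / ((n.factorial : ℂ) * (k.factorial : ℂ)) =
          poch a (n + k) / ((n + k).factorial : ℂ) * ((n + k).choose n : ℂ) := by
        have h1 : (n.factorial : ℂ) ≠ 0 := by exact_mod_cast n.factorial_ne_zero
        have h2 : (k.factorial : ℂ) ≠ 0 := by exact_mod_cast k.factorial_ne_zero
        have h3 : ((n + k).factorial : ℂ) ≠ 0 := by exact_mod_cast (n + k).factorial_ne_zero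
        have h4 : ((n + k).choose n : ℂ) * n.factorial * k.factorial = (n + k).factorial := by
          exact_mod_cast Nat.choose_symm_add (a := n) (b := k) ▸
            Nat.add_choose_mul_factorial_mul_factorial n k
        rw [← h4] at h3 ⊢
        have h5 : ((n + k).choose n : ℂ) ≠ 0 := left_ne_zero_of_mul (left_ne_zero_of_mul h3)
        field_simp
      rw [hfac, norm_mul, Complex.norm_natCast]
      have h5 : (((n + k).choose n : ℕ) : ℝ) ≤ 2 ^ (n + k) := by
        exact_mod_cast Nat.choose_le_two_pow _ _
      have h6 : (((n + k : ℕ) : ℝ) + 1) ^ (a.re - 1) ≤ ((n : ℝ) + 1) ^ e₂ * ((k : ℝ) + 1) ^ e₂ := by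
        rw [← Real.mul_rpow (by positivity) (by positivity)]
        calc _ ≤ (((n + k : ℕ) : ℝ) + 1) ^ e₂ :=
              Real.rpow_le_rpow_of_exponent_le (by push_cast; linarith) (le_max_right _ _)
          _ ≤ _ := by
              refine Real.rpow_le_rpow (by positivity) ?_ (le_max_left _ _)
              push_cast
              nlinarith
      have h7 := H₂ (n + k)
      calc _ ≤ (C₂ * (((n + k : ℕ) : ℝ) + 1) ^ (a.re - 1)) * 2 ^ (n + k) := by gcongr
        _ ≤ _ := by gcongr
    simp only [hf, norm_mul, norm_pow, norm_neg, norm_one, one_pow, mul_one]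
    rw [Real.rpow_add (by positivity)]
    calc _ ≤ (C₁ * ((n : ℝ) + 1) ^ e₁) *
          (C₂ * (((n : ℝ) + 1) ^ e₂ * ((k : ℝ) + 1) ^ e₂) * 2 ^ (n + k)) * ‖y‖ ^ (n + k) := by
          gcongr
      _ = _ := by rw [mul_pow, mul_pow, pow_add, pow_add]; ring
  have hrow : ∀ n : ℕ, ∑' k, f (n, k) = (1 - y) ^ (-a) *
      (poch a n * poch (c - b) n / (poch c n * (n.factorial : ℂ)) * (y / (y - 1)) ^ n) := by
    intro n
    have hb := (hasSum_poch_div_factorial (a + n) hy1).mul_left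
      (poch (c - b) n / poch c n * (-1) ^ n * (poch a n / (n.factorial : ℂ)) * y ^ n)
    have : (fun k => f (n, k)) = fun k => poch (c - b) n / poch c n * (-1) ^ n *
        (poch a n / (n.factorial : ℂ)) * y ^ n *
        (poch (a + n) k / (k.factorial : ℂ) * y ^ k) := by
      funext k
      simp only [hf, poch_add, pow_add]
      field_simp
    rw [this, hb.tsum_eq, neg_add, Complex.cpow_add _ _ h1y, Complex.cpow_neg (1 - y) (n : ℂ),
      Complex.cpow_natCast]
    have e : y - 1 = -(1 - y) := by ring
    rw [e, div_neg, ← neg_one_mul (y / _), mul_pow, div_pow]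
    field_simp
  have hdiag : ∀ N : ℕ, ∑ p ∈ Finset.HasAntidiagonal.antidiagonal N, f p =
      poch a N * poch b N / (poch c N * (N.factorial : ℂ)) * y ^ N := by
    intro N
    have hcv := sum_choose_mul_poch c (c - b) N
    rw [sub_sub_cancel] at hcv
    rw [Finset.Nat.sum_antidiagonal_eq_sum_range_succ_mk, ← hcv, Finset.mul_sum, Finset.sum_div,
      Finset.sum_mul]
    refine Finset.sum_congr rfl fun n hn => ?_
    have hn' : n ≤ N := Nat.lt_succ_iff.1 (Finset.mem_range.1 hn)
    have hc1 := poch_ne_zero hc n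
    have hc2 := poch_ne_zero hc N
    have h0 : poch c N = poch c n * poch (c + n) (N - n) := by
      rw [← poch_add, Nat.add_sub_cancel' hn']
    have hc3 : poch (c + n) (N - n) ≠ 0 := by
      rw [h0] at hc2
      exact right_ne_zero_of_mul hc2
    have h1 : (n.factorial : ℂ) ≠ 0 := by exact_mod_cast n.factorial_ne_zero
    have h2 : ((N - n).factorial : ℂ) ≠ 0 := by exact_mod_cast (N - n).factorial_ne_zero
    have h3 : (N.factorial : ℂ) ≠ 0 := by exact_mod_cast N.factorial_ne_zero
    have h4 : (N.choose n : ℂ) * n.factorial * (N - n).factorial = N.factorial := by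
      exact_mod_cast Nat.choose_mul_factorial_mul_factorial hn'
    simp only [hf]
    rw [← h4] at h3
    rw [Nat.add_sub_cancel' hn', h0, ← h4]
    have h5 : (N.choose n : ℂ) ≠ 0 := left_ne_zero_of_mul (left_ne_zero_of_mul h3)
    field_simp
  rw [← tsum_mul_left]
  simp_rw [← hrow, ← hdiag]
  rw [← tsum_prod_eq_tsum_sum_antidiagonal hfs, hfs.tsum_prod]

/-! ### Appell's function `F₃` on the segment -/

/-- The coefficient `(a)_m (b)_m (a')_n (c - b' + m)_n / ((c)_{m + n} m! n!)` of the double series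
that Pfaff's transformation in the second variable produces from `F₃`. -/
def f3Coeff (a a' b b' c : ℂ) (i : ℕ × ℕ) : ℂ :=
  poch a i.1 / poch c i.1 * (poch b i.1 / (i.1.factorial : ℂ)) *
    (poch a' i.2 / (i.2.factorial : ℂ)) * (poch (c - b' + i.1) i.2 / poch (c + i.1) i.2)

lemma exists_norm_f3Coeff_le (a a' b b' : ℂ) {c : ℂ} (hc : 0 < c.re) :
    ∃ C : ℝ, 0 < C ∧ ∀ m n : ℕ, ‖f3Coeff a a' b b' c (m, n)‖ ≤
      C * (((m : ℝ) + 1) ^ ((a + b + b' - c).re - 1) * ((n : ℝ) + 1) ^ (a'.re - 1) *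
        ((m : ℝ) + n + 1) ^ (-b'.re)) := by
  obtain ⟨C₁, h₁, H₁⟩ := exists_norm_poch_div_le_rpow a hc
  obtain ⟨C₂, h₂, H₂⟩ := exists_norm_poch_div_factorial_le b
  obtain ⟨C₃, h₃, H₃⟩ := exists_norm_poch_div_factorial_le a'
  obtain ⟨C₄, h₄, H₄⟩ := exists_norm_poch_div_le (c - b') hc
  refine ⟨C₁ * C₂ * C₃ * C₄, by positivity, fun m n => ?_⟩
  simp only [f3Coeff, norm_mul]
  have e4 : (((m : ℝ) + n + 1) / (m + 1)) ^ (c - b' - c).re =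
      ((m : ℝ) + n + 1) ^ (-b'.re) * ((m : ℝ) + 1) ^ b'.re := by
    rw [show (c - b' - c).re = -b'.re by simp, Real.div_rpow (by positivity) (by positivity),
      Real.rpow_neg (show (0 : ℝ) ≤ (m : ℝ) + 1 by positivity), div_inv_eq_mul]
  have e : (a + b + b' - c).re - 1 = (a - c).re + (b.re - 1) + b'.re := by simp; ring
  have H₄' := H₄ m n
  rw [e4] at H₄'
  rw [e, Real.rpow_add (by positivity), Real.rpow_add (by positivity)]
  calc _ ≤ (C₁ * ((m : ℝ) + 1) ^ (a - c).re) * (C₂ * ((m : ℝ) + 1) ^ (b.re - 1)) *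
        (C₃ * ((n : ℝ) + 1) ^ (a'.re - 1)) *
        (C₄ * (((m : ℝ) + n + 1) ^ (-b'.re) * ((m : ℝ) + 1) ^ b'.re)) := by
        gcongr
        exacts [H₁ m, H₂ m, H₃ n]
    _ = _ := by ring

lemma summable_norm_f3Coeff_mul_pow (a a' b b' : ℂ) {c : ℂ} (hc : 0 < c.re) {r : ℝ} (hr0 : 0 ≤ r)
    (hr : r < 1) :
    Summable fun i : ℕ × ℕ => ‖f3Coeff a a' b b' c i‖ * r ^ i.1 * r ^ i.2 := by
  obtain ⟨C, hC, H⟩ := exists_norm_f3Coeff_le a a' b b' hc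
  have hs := (summable_rpow_mul_geometric ((a + b + b' - c).re - 1 + |b'.re|) hr0 hr).mul_of_nonneg
      (summable_rpow_mul_geometric (a'.re - 1 + |b'.re|) hr0 hr) (fun _ => by positivity)
      (fun _ => by positivity)
  refine Summable.of_nonneg_of_le (fun i => by positivity) (fun ⟨m, n⟩ => ?_) (hs.mul_left C)
  have hm : (0 : ℝ) ≤ m := Nat.cast_nonneg m
  have hn : (0 : ℝ) ≤ n := Nat.cast_nonneg n
  have h1 : ((m : ℝ) + n + 1) ^ (-b'.re) ≤ ((m : ℝ) + 1) ^ |b'.re| * ((n : ℝ) + 1) ^ |b'.re| := by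
    rw [← Real.mul_rpow (by positivity) (by positivity)]
    calc _ ≤ ((m : ℝ) + n + 1) ^ |b'.re| :=
          Real.rpow_le_rpow_of_exponent_le (by linarith) (neg_le_abs _)
      _ ≤ _ := Real.rpow_le_rpow (by positivity) (by nlinarith) (abs_nonneg _)
  simp only
  rw [Real.rpow_add (by positivity) _ |b'.re|, Real.rpow_add (by positivity) _ |b'.re|]
  calc _ ≤ C * (((m : ℝ) + 1) ^ ((a + b + b' - c).re - 1) * ((n : ℝ) + 1) ^ (a'.re - 1) *
        (((m : ℝ) + 1) ^ |b'.re| * ((n : ℝ) + 1) ^ |b'.re|)) * r ^ m * r ^ n := by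
        gcongr
        refine (H m n).trans ?_
        gcongr
    _ = _ := by ring

lemma norm_f3Coeff_mul_pow_le (a a' b b' c : ℂ) {x w : ℂ} {r : ℝ} (hx : ‖x‖ ≤ r) (hw : ‖w‖ ≤ r)
    (i : ℕ × ℕ) : ‖f3Coeff a a' b b' c i * x ^ i.1 * w ^ i.2‖ ≤
      ‖f3Coeff a a' b b' c i‖ * r ^ i.1 * r ^ i.2 := by
  have : 0 ≤ r := (norm_nonneg _).trans hx
  rw [norm_mul, norm_mul, norm_pow, norm_pow]
  gcongr

lemma appellF3Term_eq (a a' b b' c x y : ℂ) (m n : ℕ) :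
    appellF3Term a a' b b' c x y (m, n) =
      poch a m * poch b m / (poch c m * (m.factorial : ℂ)) * x ^ m *
        (poch a' n * poch b' n / (poch (c + m) n * (n.factorial : ℂ)) * y ^ n) := by
  rw [appellF3Term]
  simp only
  change poch a m * poch a' n * poch b m * poch b' n /
    (poch c (m + n) * (m.factorial : ℂ) * (n.factorial : ℂ)) * x ^ m * y ^ n = _
  rw [poch_add]
  simp only [div_eq_mul_inv, mul_inv]
  ring

lemma summable_appellF3Term (a a' b b' : ℂ) {c x y : ℂ} (hc : 0 < c.re) (hx : ‖x‖ < 1)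
    (hy : ‖y‖ < 1) : Summable (appellF3Term a a' b b' c x y) := by
  obtain ⟨C₁, h₁, H₁⟩ := exists_norm_poch_div_le_rpow a hc
  obtain ⟨C₂, h₂, H₂⟩ := exists_norm_poch_div_factorial_le b
  obtain ⟨C₃, h₃, H₃⟩ := exists_norm_poch_div_factorial_le a'
  obtain ⟨C₄, h₄, H₄⟩ := exists_norm_poch_div_le_rpow b' hc
  have hs := (summable_rpow_mul_geometric ((a - c).re + (b.re - 1)) (norm_nonneg _) hx).mul_of_nonneg
      (summable_rpow_mul_geometric ((a'.re - 1) + (b' - c).re) (norm_nonneg _) hy)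
      (fun _ => by positivity) (fun _ => by positivity)
  refine Summable.of_norm_bounded (hs.mul_left (C₁ * C₂ * C₃ * C₄)) fun ⟨m, n⟩ => ?_
  have e : appellF3Term a a' b b' c x y (m, n) =
      (poch a m / poch c m) * (poch b m / (m.factorial : ℂ)) * (poch a' n / (n.factorial : ℂ)) *
        (poch b' n / poch (c + m) n) * x ^ m * y ^ n := by
    rw [appellF3Term_eq]
    simp only [div_eq_mul_inv, mul_inv]
    ring
  have h5 : ‖poch b' n / poch (c + m) n‖ ≤ ‖poch b' n / poch c n‖ := by
    rw [norm_div, norm_div]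
    have h3 : 0 < ‖poch c n‖ := norm_pos_iff.2 (poch_ne_zero hc n)
    gcongr
    exact norm_poch_le_norm_poch_add hc m n
  rw [e]
  simp only [norm_mul, norm_pow]
  rw [Real.rpow_add (by positivity), Real.rpow_add (by positivity)]
  calc _ ≤ (C₁ * ((m : ℝ) + 1) ^ (a - c).re) * (C₂ * ((m : ℝ) + 1) ^ (b.re - 1)) *
        (C₃ * ((n : ℝ) + 1) ^ (a'.re - 1)) * (C₄ * ((n : ℝ) + 1) ^ (b' - c).re) *
        ‖x‖ ^ m * ‖y‖ ^ n := by
        gcongr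
        exacts [H₁ m, H₂ m, H₃ n, h5.trans (H₄ n)]
    _ = _ := by ring

lemma norm_div_sub_one_lt_one {y : ℂ} (hy : ‖y‖ < 1 / 2) : ‖y / (y - 1)‖ < 1 := by
  have h : 1 ≤ ‖y - 1‖ + ‖y‖ := by
    have := norm_add_le (1 - y) y
    rwa [sub_add_cancel, norm_one, norm_sub_rev] at this
  rw [norm_div, div_lt_one (by linarith)]
  linarith

/-- Pfaff's transformation of `F₃` in its second variable. -/
lemma appellF3Series_eq_pfaff (a a' b b' : ℂ) {c x y : ℂ} (hc : 0 < c.re) (hx : ‖x‖ < 1)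
    (hy : ‖y‖ < 1 / 2) :
    appellF3Series a a' b b' c x y = (1 - y) ^ (-a') *
      ∑' i : ℕ × ℕ, f3Coeff a a' b b' c i * x ^ i.1 * (y / (y - 1)) ^ i.2 := by
  have hs : Summable fun i : ℕ × ℕ =>
      f3Coeff a a' b b' c i * x ^ i.1 * (y / (y - 1)) ^ i.2 := by
    have hr : max ‖x‖ ‖y / (y - 1)‖ < 1 := max_lt hx (norm_div_sub_one_lt_one hy)
    refine Summable.of_norm_bounded (summable_norm_f3Coeff_mul_pow a a' b b' hc
      ((norm_nonneg _).trans (le_max_left _ _)) hr) fun i => ?_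
    exact norm_f3Coeff_mul_pow_le a a' b b' c (le_max_left _ _) (le_max_right _ _) i
  have hs0 := summable_appellF3Term a a' b b' hc hx (y := y) (by linarith)
  rw [appellF3Series, hs0.tsum_prod, hs.tsum_prod, ← tsum_mul_left]
  refine tsum_congr fun m => ?_
  have hcm : 0 < (c + m).re := by simp; positivity
  simp_rw [appellF3Term_eq]
  rw [tsum_mul_left, tsum_hypergeometric_eq_pfaff a' b' hcm hy, mul_left_comm, ← tsum_mul_left]
  congr 1
  refine tsum_congr fun n => ?_
  simp only [f3Coeff]
  rw [show c + m - b' = c - b' + m by ring]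
  simp only [div_eq_mul_inv, mul_inv]
  ring

/-- The right-hand side of Pfaff's transformation continues `F₃` along the segment to `(u, v)`,
since `v / (v - 1)` stays in the unit disc as long as `Re v < 1 / 2`. -/
lemma isAppellF3Continuation_pfaff (a a' b b' : ℂ) {c : ℂ} (hc : 0 < c.re) {u v : ℝ} (hu0 : 0 ≤ u)
    (hu : u < 1) (hv : v ≤ 0) :
    IsAppellF3Continuation a a' b b' c u v fun s => (1 - s * v) ^ (-a') *
      ∑' i : ℕ × ℕ, f3Coeff a a' b b' c i * (s * u) ^ i.1 * (s * v / (s * v - 1)) ^ i.2 := by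
  constructor
  · have hv1 : -v / (1 - v) < 1 := by rw [div_lt_one (by linarith)]; linarith
    -- On the set `U` below the double series is dominated by a geometric one with ratio `r`.
    obtain ⟨r, hr1, hr⟩ := exists_between (max_lt hu hv1)
    obtain ⟨hur, hvr⟩ := max_lt_iff.1 hr1
    have hr0 : 0 < r := hu0.trans_lt hur
    rw [div_lt_iff₀ (by linarith)] at hvr
    set U : Set ℂ := {s | ‖s * u‖ < r ∧ ‖s * v‖ < r * ‖s * v - 1‖} with hU
    have hUo : IsOpen U := by
      exact IsOpen.inter
        (isOpen_lt (f := fun s : ℂ => ‖s * (u : ℂ)‖) (g := fun _ => r) (by fun_prop) (by fun_prop))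
        (isOpen_lt (f := fun s : ℂ => ‖s * (v : ℂ)‖) (g := fun s : ℂ => r * ‖s * (v : ℂ) - 1‖)
          (by fun_prop) (by fun_prop))
    have hseg : segment ℝ (0 : ℂ) 1 ⊆ U := by
      rw [segment_eq_image]
      rintro s ⟨θ, ⟨h0, h1⟩, rfl⟩
      have e1 : (((1 - θ) • (0 : ℂ) + θ • (1 : ℂ)) * u) = ((θ * u : ℝ) : ℂ) := by simp
      have e2 : (((1 - θ) • (0 : ℂ) + θ • (1 : ℂ)) * v) = ((θ * v : ℝ) : ℂ) := by simp
      have e3 : ((θ * v : ℝ) : ℂ) - 1 = ((θ * v - 1 : ℝ) : ℂ) := by push_cast; rfl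
      simp only [hU, Set.mem_ofPred_eq]
      rw [e1, e2, e3, Complex.norm_real, Complex.norm_real, Complex.norm_real]
      rw [Real.norm_of_nonneg (by positivity),
        Real.norm_of_nonpos (mul_nonpos_of_nonneg_of_nonpos h0 hv),
        Real.norm_of_nonpos (by nlinarith)]
      have h2 : θ * (-v * (1 - r)) ≤ 1 * (-v * (1 - r)) :=
        mul_le_mul_of_nonneg_right h1 (mul_nonneg (by linarith) (by linarith))
      constructor <;> nlinarith
    have hne : ∀ s ∈ U, s * v - 1 ≠ 0 := by
      rintro s ⟨-, hs⟩ h0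
      rw [h0, norm_zero, mul_zero] at hs
      exact absurd hs (not_lt.2 (norm_nonneg _))
    have hslit : ∀ s ∈ U, 1 - s * v ∈ Complex.slitPlane := by
      rintro s ⟨-, hs⟩
      left
      have h1 : ‖s * v‖ < ‖s * v - 1‖ := hs.trans_le (by nlinarith [norm_nonneg (s * (v : ℂ) - 1)])
      rw [← sq_lt_sq₀ (norm_nonneg _) (norm_nonneg _), ← Complex.normSq_eq_norm_sq,
        ← Complex.normSq_eq_norm_sq, Complex.normSq_apply, Complex.normSq_apply] at h1
      simp only [Complex.sub_re, Complex.sub_im, Complex.one_re, Complex.one_im] at h1 ⊢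
      nlinarith
    have hdiff : DifferentiableOn ℂ (fun s : ℂ => (1 - s * v) ^ (-a') *
        ∑' i : ℕ × ℕ, f3Coeff a a' b b' c i * (s * u) ^ i.1 * (s * v / (s * v - 1)) ^ i.2) U := by
      refine DifferentiableOn.mul ?_ ?_
      · exact DifferentiableOn.cpow (by fun_prop) (by fun_prop) hslit
      · refine Complex.differentiableOn_tsum_of_summable_norm
          (summable_norm_f3Coeff_mul_pow a a' b b' hc hr0.le hr) (fun i => ?_) hUo ?_
        · refine DifferentiableOn.mul (by fun_prop) (DifferentiableOn.pow ?_ _)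
          exact DifferentiableOn.div (by fun_prop) (by fun_prop) hne
        · rintro i s hs
          refine norm_f3Coeff_mul_pow_le a a' b b' c hs.1.le ?_ i
          rw [norm_div, div_le_iff₀ (norm_pos_iff.2 (hne s hs))]
          exact hs.2.le
    exact fun s hs => hdiff.analyticAt (hUo.mem_nhds (hseg hs))
  · have h1 : ∀ᶠ s : ℂ in 𝓝 0, ‖s * u‖ < 1 := by
      refine (isOpen_lt (f := fun s : ℂ => ‖s * (u : ℂ)‖) (by fun_prop)
        continuous_const).mem_nhds ?_
      simp
    have h2 : ∀ᶠ s : ℂ in 𝓝 0, ‖s * v‖ < 1 / 2 := by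
      refine (isOpen_lt (f := fun s : ℂ => ‖s * (v : ℂ)‖) (by fun_prop)
        continuous_const).mem_nhds ?_
      simp
    filter_upwards [h1, h2] with s hs1 hs2
    exact (appellF3Series_eq_pfaff a a' b b' hc hs1 hs2).symm

/-- On the curve `(1 - u) (1 - v) = 1` that carries the kernel, `v / (v - 1) = u`, so that `F₃`
becomes a power series in `u`. -/
lemma appellF3_kernel (a a' b b' : ℂ) {c : ℂ} (hc : 0 < c.re) {x t : ℝ} (ht : 0 < t) (htx : t ≤ x) :
    appellF3 a a' b b' c ((1 - t / x : ℝ) : ℂ) ((1 - x / t : ℝ) : ℂ) =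
      ((x / t : ℝ) : ℂ) ^ (-a') *
        ∑' i : ℕ × ℕ, f3Coeff a a' b b' c i * ((1 - t / x : ℝ) : ℂ) ^ (i.1 + i.2) := by
  have hx : 0 < x := ht.trans_le htx
  have h1 : t / x ≤ 1 := (div_le_one hx).2 htx
  have h2 : 1 ≤ x / t := (one_le_div ht).2 htx
  have h3 : 0 < t / x := div_pos ht hx
  rw [appellF3_eq_of_continuation (isAppellF3Continuation_pfaff a a' b b' hc (by linarith)
    (by linarith) (by linarith))]
  have e1 : (1 : ℂ) - 1 * ((1 - x / t : ℝ) : ℂ) = ((x / t : ℝ) : ℂ) := by push_cast; ring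
  have htC : (t : ℂ) ≠ 0 := by exact_mod_cast ht.ne'
  have hxC : (x : ℂ) ≠ 0 := by exact_mod_cast hx.ne'
  have e2 : 1 * ((1 - x / t : ℝ) : ℂ) / (1 * ((1 - x / t : ℝ) : ℂ) - 1) =
      ((1 - t / x : ℝ) : ℂ) := by
    rw [show 1 * ((1 - x / t : ℝ) : ℂ) - 1 = -(x / t) by push_cast; ring]
    push_cast
    field_simp
    ring
  simp only [e1, e2]
  simp only [one_mul, pow_add, mul_assoc]

/-! ### A contiguous relation for `F₃` -/

/-- The term `(m, n + 1)` of the difference of the first two series is the term `(m, n)` of the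
third one, and the terms `(m, 0)` of the first two agree. -/
lemma appellF3Series_contiguous (a a' b b' : ℂ) {c x y : ℂ} (hc : 0 < c.re) (hx : ‖x‖ < 1)
    (hy : ‖y‖ < 1) :
    appellF3Series a a' b b' c x y = appellF3Series a (a' + 1) b b' c x y -
      b' / c * y * appellF3Series a (a' + 1) b (b' + 1) (c + 1) x y := by
  have hc1 : 0 < (c + 1).re := by simp; positivity
  have hc0 : c ≠ 0 := fun h => by simp [h] at hc
  have hs1 := summable_appellF3Term a a' b b' hc hx hy
  have hs2 := summable_appellF3Term a (a' + 1) b b' hc hx hy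
  have hs3 := summable_appellF3Term a (a' + 1) b (b' + 1) hc1 hx hy
  rw [eq_sub_iff_add_eq', ← eq_sub_iff_add_eq, appellF3Series, appellF3Series, appellF3Series,
    ← tsum_mul_left, ← hs2.tsum_sub hs1, (hs2.sub hs1).tsum_prod, (hs3.mul_left _).tsum_prod]
  refine tsum_congr fun m => ?_
  rw [((hs2.sub hs1).prod_factor m).tsum_eq_zero_add]
  have h0 : appellF3Term a (a' + 1) b b' c x y (m, 0) - appellF3Term a a' b b' c x y (m, 0) = 0 := by
    simp [appellF3Term_eq]
  rw [h0, zero_add]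
  refine tsum_congr fun n => ?_
  symm
  simp only [appellF3Term]
  change _ = b' / c * y * (poch a m * poch (a' + 1) n * poch b m * poch (b' + 1) n /
    (poch (c + 1) (m + n) * (m.factorial : ℂ) * (n.factorial : ℂ)) * x ^ m * y ^ n)
  change poch a m * poch (a' + 1) (n + 1) * poch b m * poch b' (n + 1) /
    (poch c (m + (n + 1)) * (m.factorial : ℂ) * ((n + 1).factorial : ℂ)) * x ^ m * y ^ (n + 1) -
    poch a m * poch a' (n + 1) * poch b m * poch b' (n + 1) /
    (poch c (m + (n + 1)) * (m.factorial : ℂ) * ((n + 1).factorial : ℂ)) * x ^ m * y ^ (n + 1) = _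
  rw [poch_succ (a' + 1), poch_succ_left a', poch_succ_left b', ← add_assoc m n 1,
    poch_succ_left c, Nat.factorial_succ]
  have hn : (n : ℂ) + 1 ≠ 0 := by exact_mod_cast n.succ_ne_zero
  have h1 := poch_ne_zero hc1 (m + n)
  have h2 : (n.factorial : ℂ) ≠ 0 := by exact_mod_cast n.factorial_ne_zero
  have h3 : (m.factorial : ℂ) ≠ 0 := by exact_mod_cast m.factorial_ne_zero
  push_cast
  field_simp
  ring

/-- The contiguous relation carries over to the continuations along the segment. -/
lemma appellF3_contiguous (a a' b b' : ℂ) {c : ℂ} (hc : 0 < c.re) {u v : ℝ} (hu0 : 0 ≤ u)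
    (hu : u < 1) (hv : v ≤ 0) :
    appellF3 a a' b b' c u v = appellF3 a (a' + 1) b b' c u v -
      b' / c * v * appellF3 a (a' + 1) b (b' + 1) (c + 1) u v := by
  have hc1 : 0 < (c + 1).re := by simp; positivity
  have h1 := isAppellF3Continuation_pfaff a (a' + 1) b b' hc hu0 hu hv
  have h2 := isAppellF3Continuation_pfaff a (a' + 1) b (b' + 1) hc1 hu0 hu hv
  set g₁ : ℂ → ℂ := fun s => (1 - s * v) ^ (-(a' + 1)) *
    ∑' i : ℕ × ℕ, f3Coeff a (a' + 1) b b' c i * (s * u) ^ i.1 * (s * v / (s * v - 1)) ^ i.2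
  set g₂ : ℂ → ℂ := fun s => (1 - s * v) ^ (-(a' + 1)) *
    ∑' i : ℕ × ℕ, f3Coeff a (a' + 1) b (b' + 1) (c + 1) i * (s * u) ^ i.1 *
      (s * v / (s * v - 1)) ^ i.2
  have h3 : IsAppellF3Continuation a a' b b' c u v
      fun s => g₁ s - b' / c * (s * v) * g₂ s := by
    constructor
    · intro s hs
      refine (h1.1 s hs).sub (AnalyticAt.mul (by fun_prop) (h2.1 s hs))
    · have e1 : ∀ᶠ s : ℂ in 𝓝 0, ‖s * u‖ < 1 := by
        refine (isOpen_lt (f := fun s : ℂ => ‖s * (u : ℂ)‖) (by fun_prop)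
          continuous_const).mem_nhds ?_
        simp
      have e2 : ∀ᶠ s : ℂ in 𝓝 0, ‖s * v‖ < 1 := by
        refine (isOpen_lt (f := fun s : ℂ => ‖s * (v : ℂ)‖) (by fun_prop)
          continuous_const).mem_nhds ?_
        simp
      filter_upwards [h1.2, h2.2, e1, e2] with s hs1 hs2 hs3 hs4
      rw [hs1, hs2, appellF3Series_contiguous a a' b b' hc hs3 hs4]
  rw [appellF3_eq_of_continuation h3, appellF3_eq_of_continuation h1,
    appellF3_eq_of_continuation h2, one_mul]

/-! ### Termwise integration -/

open MeasureTheory in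
lemma integrable_tsum_of_summable_integral_norm {X ι : Type*} [MeasurableSpace X] {μ : Measure X}
    [Countable ι] {F : ι → X → ℂ} (hF : ∀ i, Integrable (F i) μ)
    (hsum : Summable fun i => ∫ t, ‖F i t‖ ∂μ) (hpt : ∀ᵐ t ∂μ, Summable fun i => F i t) :
    Integrable (fun t => ∑' i, F i t) μ := by
  refine ⟨?_, ?_⟩
  · refine aestronglyMeasurable_of_tendsto_ae (atTop : Filter (Finset ι))
      (f := fun s t => ∑ i ∈ s, F i t) (fun s => ?_) ?_
    · exact (integrable_finsetSum s fun i _ => hF i).aestronglyMeasurable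
    · filter_upwards [hpt] with t ht using ht.hasSum
  · calc ∫⁻ t, ‖∑' i, F i t‖ₑ ∂μ ≤ ∫⁻ t, ∑' i, ‖F i t‖ₑ ∂μ :=
          lintegral_mono fun t => enorm_tsum_le_tsum_enorm
      _ = ∑' i, ∫⁻ t, ‖F i t‖ₑ ∂μ := lintegral_tsum fun i => (hF i).1.enorm
      _ = ∑' i, ENNReal.ofReal (∫ t, ‖F i t‖ ∂μ) := by
          refine tsum_congr fun i => ?_
          rw [ofReal_integral_norm_eq_lintegral_enorm (hF i)]
      _ < ⊤ := hsum.tsum_ofReal_lt_top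

/-- The Beta kernel on `(0, x)`. -/
def betaKernel (s w : ℂ) (x t : ℝ) : ℂ := (t : ℂ) ^ (s - 1) * ((x - t : ℝ) : ℂ) ^ (w - 1)

open MeasureTheory in
lemma integrableOn_betaKernel {s w : ℂ} (hs : 0 < s.re) (hw : 0 < w.re) {x : ℝ} (hx : 0 < x) :
    IntegrableOn (betaKernel s w x) (Set.Ioo 0 x) := by
  have h := (Complex.betaIntegral_convergent hs hw).comp_mul_left (c := x⁻¹)
  simp only [zero_div, one_div, inv_inv] at h
  rw [intervalIntegrable_iff_integrableOn_Ioo_of_le hx.le] at h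
  refine IntegrableOn.congr_fun (Integrable.const_mul h ((x : ℂ) ^ (s - 1) * (x : ℂ) ^ (w - 1)))
    (fun t ht => ?_) measurableSet_Ioo
  have h1 : 0 ≤ x⁻¹ * t := mul_nonneg (by positivity) ht.1.le
  have h2 : 0 ≤ 1 - x⁻¹ * t := by
    rw [inv_mul_eq_div, sub_nonneg, div_le_one hx]
    exact ht.2.le
  simp only [betaKernel]
  rw [show (1 : ℂ) - ((x⁻¹ * t : ℝ) : ℂ) = ((1 - x⁻¹ * t : ℝ) : ℂ) by push_cast; rfl,
    mul_mul_mul_comm, ← Complex.mul_cpow_ofReal_nonneg hx.le h1,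
    ← Complex.mul_cpow_ofReal_nonneg hx.le h2]
  congr 2
  · rw [← Complex.ofReal_mul, mul_inv_cancel_left₀ hx.ne']
  · rw [← Complex.ofReal_mul, mul_sub, mul_one, mul_inv_cancel_left₀ hx.ne']

open MeasureTheory in
lemma integral_betaKernel {s w : ℂ} (hs : 0 < s.re) (hw : 0 < w.re) {x : ℝ} (hx : 0 < x) :
    ∫ t in Set.Ioo 0 x, betaKernel s w x t =
      (x : ℂ) ^ (s + w - 1) * (Complex.Gamma s * Complex.Gamma w / Complex.Gamma (s + w)) := by
  rw [← Complex.betaIntegral_eq_Gamma_mul_div s w hs hw, ← Complex.betaIntegral_scaled s w hx,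
    intervalIntegral.integral_of_le hx.le, integral_Ioc_eq_integral_Ioo]
  simp only [betaKernel, Complex.ofReal_sub]

open MeasureTheory in
/-- The absolute value of the Beta kernel is the Beta kernel of the real parts. -/
lemma integral_norm_betaKernel (s w : ℂ) (x : ℝ) :
    ∫ t in Set.Ioo 0 x, ‖betaKernel s w x t‖ =
      ‖∫ t in Set.Ioo 0 x, betaKernel (s.re : ℂ) (w.re : ℂ) x t‖ := by
  have h : ∫ t in Set.Ioo 0 x, betaKernel (s.re : ℂ) (w.re : ℂ) x t =
      ∫ t in Set.Ioo 0 x, ((‖betaKernel s w x t‖ : ℝ) : ℂ) := by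
    refine setIntegral_congr_fun measurableSet_Ioo fun t ht => ?_
    simp only [betaKernel]
    rw [norm_mul, Complex.norm_cpow_eq_rpow_re_of_pos ht.1,
      Complex.norm_cpow_eq_rpow_re_of_pos (sub_pos.2 ht.2), Complex.ofReal_mul,
      Complex.ofReal_cpow ht.1.le, Complex.ofReal_cpow (sub_pos.2 ht.2).le]
    simp
  rw [h, integral_complex_ofReal, Complex.norm_real,
    Real.norm_of_nonneg (integral_nonneg fun t => norm_nonneg _)]

lemma summable_rpow_mul_rpow_mul_rpow {p a q : ℝ} (ha : 0 < a) (h1 : a < q) (h2 : a + p < q) :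
    Summable fun i : ℕ × ℕ => ((i.1 : ℝ) + 1) ^ (p - 1) * ((i.2 : ℝ) + 1) ^ (a - 1) *
      ((i.1 : ℝ) + i.2 + 1) ^ (-q) := by
  -- Enlarging `p` to some `p' > 0` leaves room to split `(m + n + 1) ^ (-q)` between the factors.
  obtain ⟨p', hp', hp'q⟩ := exists_between (max_lt (show 0 < q - a by linarith)
    (show p < q - a by linarith))
  obtain ⟨hp0, hpp⟩ := max_lt_iff.1 hp'
  set δ := (q - a - p') / 2 with hδ
  have hδ0 : 0 < δ := by linarith
  have hs := (summable_nat_add_one_rpow (p := p' - 1 + -(p' + δ)) (by linarith)).mul_of_nonneg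
    (summable_nat_add_one_rpow (p := a - 1 + -(a + δ)) (by linarith)) (fun _ => by positivity)
    (fun _ => by positivity)
  refine Summable.of_nonneg_of_le (fun i => by positivity) (fun ⟨m, n⟩ => ?_) hs
  have hm : (0 : ℝ) ≤ m := Nat.cast_nonneg m
  have hn : (0 : ℝ) ≤ n := Nat.cast_nonneg n
  simp only
  have e : -q = -(p' + δ) + -(a + δ) := by rw [hδ]; ring
  rw [e, Real.rpow_add (by positivity) (-(p' + δ)), Real.rpow_add (by positivity) (p' - 1),
    Real.rpow_add (by positivity) (a - 1)]
  have b1 : ((m : ℝ) + n + 1) ^ (-(p' + δ)) ≤ ((m : ℝ) + 1) ^ (-(p' + δ)) :=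
    Real.rpow_le_rpow_of_nonpos (by positivity) (by linarith) (by linarith)
  have b2 : ((m : ℝ) + n + 1) ^ (-(a + δ)) ≤ ((n : ℝ) + 1) ^ (-(a + δ)) :=
    Real.rpow_le_rpow_of_nonpos (by positivity) (by linarith) (by linarith)
  have b3 : ((m : ℝ) + 1) ^ (p - 1) ≤ ((m : ℝ) + 1) ^ (p' - 1) :=
    Real.rpow_le_rpow_of_exponent_le (by linarith) (by linarith)
  calc _ ≤ ((m : ℝ) + 1) ^ (p' - 1) * ((n : ℝ) + 1) ^ (a - 1) *
        (((m : ℝ) + 1) ^ (-(p' + δ)) * ((n : ℝ) + 1) ^ (-(a + δ))) := by gcongr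
    _ = _ := by ring

/-- The multiplier by which the operator acts on the power `t ^ (ρ - 1)`. -/
def msmMultiplier (α α' β β' γ ρ : ℂ) : ℂ :=
  Complex.Gamma ρ * Complex.Gamma (ρ + γ - α - α' - β) * Complex.Gamma (ρ + β' - α') *
    ((Complex.Gamma (ρ + β'))⁻¹ * (Complex.Gamma (ρ + γ - α - α'))⁻¹ *
      (Complex.Gamma (ρ + γ - α' - β))⁻¹)

/-- Summing over `n` and then over `m`, each time by Gauss's theorem. -/
lemma tsum_f3Coeff_mul (α α' β β' γ ρ : ℂ) (hγ : 0 < γ.re)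
    (h1 : 0 < (ρ + β' - α').re) (h2 : 0 < (ρ + γ - α - α' - β).re)
    (hs : Summable fun i : ℕ × ℕ => f3Coeff α α' β β' γ i *
      (poch γ (i.1 + i.2) * (Complex.Gamma (ρ + γ + (i.1 + i.2 : ℕ)))⁻¹)) :
    Complex.Gamma ρ * ∑' i : ℕ × ℕ, f3Coeff α α' β β' γ i *
      (poch γ (i.1 + i.2) * (Complex.Gamma (ρ + γ + (i.1 + i.2 : ℕ)))⁻¹) =
      msmMultiplier α α' β β' γ ρ := by
  have hrow : ∀ m : ℕ, ∑' n : ℕ, f3Coeff α α' β β' γ (m, n) *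
      (poch γ (m + n) * (Complex.Gamma (ρ + γ + (m + n : ℕ)))⁻¹) =
      Complex.Gamma (ρ + β' - α') * (Complex.Gamma (ρ + β'))⁻¹ *
        gaussTerm α β (ρ + γ - α') m := by
    intro m
    have hterm : ∀ n : ℕ, f3Coeff α α' β β' γ (m, n) *
        (poch γ (m + n) * (Complex.Gamma (ρ + γ + (m + n : ℕ)))⁻¹) =
        poch α m * poch β m / (m.factorial : ℂ) *
          gaussTerm α' (γ - β' + m) (ρ + γ + m) n := by
      intro n
      have hγm : 0 < (γ + m).re := by simp; positivity
      have p1 := poch_ne_zero hγ m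
      have p2 := poch_ne_zero hγm n
      simp only [f3Coeff, gaussTerm]
      rw [poch_add γ, Nat.cast_add, ← add_assoc]
      field_simp
    simp_rw [hterm]
    have e1 : ρ + γ + m - α' - (γ - β' + m) = ρ + β' - α' := by ring
    rw [tsum_mul_left, tsum_gaussTerm (by rwa [e1]), e1,
      show ρ + γ + m - (γ - β' + m) = ρ + β' by ring,
      show ρ + γ + m - α' = ρ + γ - α' + m by ring, gaussTerm]
    ring
  have e2 : ρ + γ - α' - α - β = ρ + γ - α - α' - β := by ring
  rw [hs.tsum_prod]
  simp only
  simp_rw [hrow]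
  rw [tsum_mul_left, tsum_gaussTerm (by rwa [e2]), e2,
    show ρ + γ - α' - α = ρ + γ - α - α' by ring, msmMultiplier]
  ring

open MeasureTheory in
/-- The image of a power function when `Re α' > 0`. Under this condition the double series may be
integrated term by term, with a Beta integral for each term. -/
lemma msm_power_of_re_pos {α α' β β' γ ρ : ℂ} (hγ : 0 < γ.re) (hρ : 0 < ρ.re)
    (h1 : 0 < (ρ + β' - α').re) (h2 : 0 < (ρ + γ - α - α' - β).re) (hα' : 0 < α'.re)
    {x : ℝ} (hx : 0 < x) :
    IntervalIntegrable (msmIntegrand α α' β β' γ (fun t : ℝ => (t : ℂ) ^ (ρ - 1)) x) volume 0 x ∧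
      msmIntegral α α' β β' γ (fun t : ℝ => (t : ℂ) ^ (ρ - 1)) x =
        (x : ℂ) ^ (ρ - α - α' + γ - 1) * msmMultiplier α α' β β' γ ρ := by
  have hxC : (x : ℂ) ≠ 0 := by exact_mod_cast hx.ne'
  have hγN : ∀ N : ℕ, 0 < (γ + N).re := fun N => by simp; positivity
  have hργ : 0 < (ρ + γ).re := by simp; positivity
  set F : ℕ × ℕ → ℝ → ℂ := fun i t => (x : ℂ) ^ (-α') * f3Coeff α α' β β' γ i *
    ((x : ℂ) ^ (i.1 + i.2))⁻¹ * betaKernel ρ (γ + (i.1 + i.2 : ℕ)) x t with hF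
  -- On `(0, x)` the integrand is the sum of the terms `F i`.
  have hterm : ∀ t ∈ Set.Ioo 0 x, ∀ i : ℕ × ℕ, F i t =
      ((x - t : ℝ) : ℂ) ^ (γ - 1) * (t : ℂ) ^ (-α') * ((x / t : ℝ) : ℂ) ^ (-α') *
        (t : ℂ) ^ (ρ - 1) * (f3Coeff α α' β β' γ i * ((1 - t / x : ℝ) : ℂ) ^ (i.1 + i.2)) := by
    intro t ht i
    have htC : (t : ℂ) ≠ 0 := by exact_mod_cast ht.1.ne'
    have hxt : ((x - t : ℝ) : ℂ) ≠ 0 := by exact_mod_cast (sub_pos.2 ht.2).ne'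
    have e1 : (t : ℂ) ^ (-α') * ((x / t : ℝ) : ℂ) ^ (-α') = (x : ℂ) ^ (-α') := by
      rw [← Complex.mul_cpow_ofReal_nonneg ht.1.le (div_pos hx ht.1).le, ← Complex.ofReal_mul,
        mul_div_cancel₀ _ ht.1.ne']
    have e2 : ((1 - t / x : ℝ) : ℂ) = ((x - t : ℝ) : ℂ) / x := by
      push_cast
      field_simp
    have e3 : ((x - t : ℝ) : ℂ) ^ (γ + (i.1 + i.2 : ℕ) - 1) =
        ((x - t : ℝ) : ℂ) ^ (γ - 1) * ((x - t : ℝ) : ℂ) ^ (i.1 + i.2) := by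
      rw [← Complex.cpow_natCast, ← Complex.cpow_add _ _ hxt]
      congr 1
      ring
    simp only [hF, betaKernel]
    rw [e3, e2, div_pow, mul_assoc (_ ^ (γ - 1)) ((t : ℂ) ^ (-α')), e1]
    ring
  have hsum : ∀ t ∈ Set.Ioo 0 x, ∑' i, F i t =
      msmIntegrand α α' β β' γ (fun t : ℝ => (t : ℂ) ^ (ρ - 1)) x t := by
    intro t ht
    rw [msmIntegrand, appellF3_kernel α α' β β' hγ ht.1 ht.2.le, tsum_congr (hterm t ht),
      tsum_mul_left]
    ring
  have hpt : ∀ t ∈ Set.Ioo 0 x, Summable fun i => F i t := by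
    intro t ht
    have hu0 : 0 ≤ 1 - t / x := by
      rw [sub_nonneg, div_le_one hx]
      exact ht.2.le
    have hu1 : 1 - t / x < 1 := by linarith [div_pos ht.1 hx]
    rw [summable_congr (hterm t ht)]
    refine Summable.mul_left _ (Summable.of_norm ?_)
    refine (summable_norm_f3Coeff_mul_pow α α' β β' hγ hu0 hu1).congr fun i => ?_
    rw [norm_mul, norm_pow, Complex.norm_real, Real.norm_of_nonneg hu0, pow_add, mul_assoc]
  have hint : ∀ i, Integrable (F i) (volume.restrict (Set.Ioo 0 x)) := fun i =>
    (integrableOn_betaKernel hρ (hγN _) hx).const_mul _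
  have hval : ∀ i, ∫ t in Set.Ioo 0 x, F i t =
      (x : ℂ) ^ (ρ - α' + γ - 1) * Complex.Gamma γ * Complex.Gamma ρ *
        (f3Coeff α α' β β' γ i *
          (poch γ (i.1 + i.2) * (Complex.Gamma (ρ + γ + (i.1 + i.2 : ℕ)))⁻¹)) := by
    intro i
    simp only [hF]
    rw [integral_const_mul, integral_betaKernel hρ (hγN _) hx, Gamma_add_nat_eq_poch hγ,
      ← add_assoc]
    have e : (x : ℂ) ^ (ρ + γ + (i.1 + i.2 : ℕ) - 1) =
        (x : ℂ) ^ α' * (x : ℂ) ^ (ρ - α' + γ - 1) * (x : ℂ) ^ (i.1 + i.2) := by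
      rw [← Complex.cpow_natCast, ← Complex.cpow_add _ _ hxC, ← Complex.cpow_add _ _ hxC]
      congr 1
      ring
    have hα0 : (x : ℂ) ^ α' ≠ 0 := by simp [Complex.cpow_eq_zero_iff, hxC]
    rw [e, Complex.cpow_neg]
    field_simp
  have hnorm : Summable fun i => ∫ t in Set.Ioo 0 x, ‖F i t‖ := by
    have hγr : 0 < ((γ.re : ℂ)).re := by simpa
    have hργr : 0 < ((ρ.re + γ.re : ℝ) : ℂ).re := by simp; positivity
    obtain ⟨C₁, hC₁, H₁⟩ := exists_norm_f3Coeff_le α α' β β' hγ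
    obtain ⟨C₂, hC₂, H₂⟩ := exists_norm_poch_div_le_rpow (γ.re : ℂ) hργr
    set D : ℝ := ‖(x : ℂ) ^ (-α')‖ * ‖(x : ℂ) ^ (ρ.re + γ.re - 1 : ℂ)‖ *
      ‖Complex.Gamma ρ.re‖ * ‖Complex.Gamma γ.re‖ / ‖Complex.Gamma (ρ.re + γ.re : ℝ)‖ with hD
    have hs := summable_rpow_mul_rpow_mul_rpow (p := (α + β + β' - γ).re) (a := α'.re)
      (q := β'.re + ρ.re) hα' (by simp at h1; linarith) (by simp at h2 ⊢; linarith)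
    refine Summable.of_nonneg_of_le (fun i => integral_nonneg fun t => norm_nonneg _)
      (fun ⟨m, n⟩ => ?_) (hs.mul_left (C₁ * C₂ * D))
    have e1 : ∫ t in Set.Ioo 0 x, ‖F (m, n) t‖ = D * (‖f3Coeff α α' β β' γ (m, n)‖ *
        ‖poch (γ.re : ℂ) (m + n) / poch ((ρ.re + γ.re : ℝ) : ℂ) (m + n)‖) := by
      simp only [hF, norm_mul]
      rw [integral_const_mul, integral_norm_betaKernel, integral_betaKernel (by simpa)
        (by simpa using hγN (m + n)) hx]
      have r1 : ((γ + ((m + n : ℕ) : ℂ)).re : ℂ) = (γ.re : ℂ) + ((m + n : ℕ) : ℂ) := by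
        simp
      have r2 : (ρ.re : ℂ) + ((γ + ((m + n : ℕ) : ℂ)).re : ℂ) =
          ((ρ.re + γ.re : ℝ) : ℂ) + ((m + n : ℕ) : ℂ) := by
        rw [r1]; push_cast; ring
      have r3 : (x : ℂ) ^ (((ρ.re + γ.re : ℝ) : ℂ) + ((m + n : ℕ) : ℂ) - 1) =
          (x : ℂ) ^ (ρ.re + γ.re - 1 : ℂ) * (x : ℂ) ^ (m + n) := by
        rw [← Complex.cpow_natCast, ← Complex.cpow_add _ _ hxC]
        congr 1
        push_cast
        ring
      rw [r2, r1, r3, Gamma_add_nat_eq_poch hγr, Gamma_add_nat_eq_poch hργr, hD]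
      have hxn : ‖(x : ℂ) ^ (m + n)‖ ≠ 0 := norm_ne_zero_iff.2 (pow_ne_zero _ hxC)
      have g1 : ‖Complex.Gamma ((ρ.re + γ.re : ℝ) : ℂ)‖ ≠ 0 :=
        norm_ne_zero_iff.2 (Complex.Gamma_ne_zero_of_re_pos hργr)
      have g2 : ‖poch ((ρ.re + γ.re : ℝ) : ℂ) (m + n)‖ ≠ 0 :=
        norm_ne_zero_iff.2 (poch_ne_zero hργr _)
      simp only [norm_mul, norm_div, norm_inv]
      field_simp
    have e2 : ((m : ℝ) + n + 1) ^ (-(β'.re + ρ.re)) =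
        ((m : ℝ) + n + 1) ^ (-β'.re) * ((m : ℝ) + n + 1) ^ (-ρ.re) := by
      rw [← Real.rpow_add (by positivity)]
      congr 1
      ring
    have H₂' := H₂ (m + n)
    rw [show ((γ.re : ℂ) - ((ρ.re + γ.re : ℝ) : ℂ)).re = -ρ.re by simp] at H₂'
    have hD0 : 0 ≤ D := by positivity
    simp only
    rw [e1, e2]
    calc _ ≤ D * ((C₁ * (((m : ℝ) + 1) ^ ((α + β + β' - γ).re - 1) *
          ((n : ℝ) + 1) ^ (α'.re - 1) * ((m : ℝ) + n + 1) ^ (-β'.re))) *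
          (C₂ * (((m + n : ℕ) : ℝ) + 1) ^ (-ρ.re))) := by
          gcongr
          exact H₁ m n
      _ = _ := by push_cast; ring
  have hhas := hasSum_integral_of_summable_integral_norm hint hnorm
  have hcongr : Set.EqOn (fun t => ∑' i, F i t)
      (msmIntegrand α α' β β' γ (fun t : ℝ => (t : ℂ) ^ (ρ - 1)) x) (Set.Ioo 0 x) := hsum
  constructor
  · rw [intervalIntegrable_iff_integrableOn_Ioo_of_le hx.le]
    refine IntegrableOn.congr_fun ?_ hcongr measurableSet_Ioo
    refine integrable_tsum_of_summable_integral_norm hint hnorm ?_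
    exact (ae_restrict_iff' measurableSet_Ioo).2 (Eventually.of_forall hpt)
  · have hΓγ := Complex.Gamma_ne_zero_of_re_pos hγ
    have hΓρ := Complex.Gamma_ne_zero_of_re_pos hρ
    have hK : (x : ℂ) ^ (ρ - α' + γ - 1) * Complex.Gamma γ * Complex.Gamma ρ ≠ 0 := by
      simp [Complex.cpow_eq_zero_iff, hxC, hΓγ, hΓρ]
    rw [setIntegral_congr_fun measurableSet_Ioo hcongr] at hhas
    simp_rw [hval] at hhas
    have hs := (summable_mul_left_iff hK).1 hhas.summable
    rw [msmIntegral, intervalIntegral.integral_of_le hx.le, integral_Ioc_eq_integral_Ioo,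
      ← hhas.tsum_eq, tsum_mul_left, ← tsum_f3Coeff_mul α α' β β' γ ρ hγ h1 h2 hs,
      show ρ - α - α' + γ - 1 = -α + (ρ - α' + γ - 1) by ring, Complex.cpow_add _ _ hxC]
    field_simp

/-! ### Power functions -/

open MeasureTheory in
/-- The image of a power function. The contiguous relation raises `Re α'` by one and keeps the
hypotheses, so that induction reduces the claim to `Re α' > 0`. -/
theorem msm_power {α α' β β' γ ρ : ℂ} (hγ : 0 < γ.re) (hρ : 0 < ρ.re)
    (h1 : 0 < (ρ + β' - α').re) (h2 : 0 < (ρ + γ - α - α' - β).re) {x : ℝ} (hx : 0 < x) :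
    IntervalIntegrable (msmIntegrand α α' β β' γ (fun t : ℝ => (t : ℂ) ^ (ρ - 1)) x) volume 0 x ∧
      msmIntegral α α' β β' γ (fun t : ℝ => (t : ℂ) ^ (ρ - 1)) x =
        (x : ℂ) ^ (ρ - α - α' + γ - 1) * msmMultiplier α α' β β' γ ρ := by
  obtain ⟨K, hK⟩ : ∃ K : ℕ, 0 < α'.re + K := by
    obtain ⟨K, hK⟩ := exists_nat_gt (-α'.re)
    exact ⟨K, by linarith⟩
  induction K generalizing α' β' γ ρ with
  | zero => exact msm_power_of_re_pos hγ hρ h1 h2 (by simpa using hK) hx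
  | succ K ih =>
    have hγ1 : 0 < (γ + 1).re := by simp; positivity
    have hγ0 : γ ≠ 0 := fun h => by simp [h] at hγ
    obtain ⟨i1, v1⟩ := ih (α' := α' + 1) (β' := β') (γ := γ) (ρ := ρ + 1) hγ
      (by simp; positivity) (by simp at h1 ⊢; linarith) (by simp at h2 ⊢; linarith)
      (by simp at hK ⊢; linarith)
    obtain ⟨i2, v2⟩ := ih (α' := α' + 1) (β' := β' + 1) (γ := γ + 1) (ρ := ρ) hγ1
      hρ (by simp at h1 ⊢; linarith) (by simp at h2 ⊢; linarith)
      (by simp at hK ⊢; linarith)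
    have hcongr : Set.EqOn
        (fun t => msmIntegrand α (α' + 1) β β' γ (fun t : ℝ => (t : ℂ) ^ (ρ + 1 - 1)) x t +
          β' / γ * msmIntegrand α (α' + 1) β (β' + 1) (γ + 1)
            (fun t : ℝ => (t : ℂ) ^ (ρ - 1)) x t)
        (msmIntegrand α α' β β' γ (fun t : ℝ => (t : ℂ) ^ (ρ - 1)) x) (Set.Ioo 0 x) := by
      intro t ht
      have htC : (t : ℂ) ≠ 0 := by exact_mod_cast ht.1.ne'
      have hxt : ((x - t : ℝ) : ℂ) ≠ 0 := by exact_mod_cast (sub_pos.2 ht.2).ne'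
      have hu0 : 0 ≤ 1 - t / x := by
        rw [sub_nonneg, div_le_one hx]
        exact ht.2.le
      have hu1 : 1 - t / x < 1 := by linarith [div_pos ht.1 hx]
      have hv : 1 - x / t ≤ 0 := by
        rw [sub_nonpos, one_le_div ht.1]
        exact ht.2.le
      simp only [msmIntegrand]
      rw [appellF3_contiguous α α' β β' hγ hu0 hu1 hv, show -(α' + 1) = -α' - 1 by ring,
        Complex.cpow_sub _ _ htC, Complex.cpow_one, show ρ + 1 - 1 = (ρ - 1) + 1 by ring,
        Complex.cpow_add _ _ htC, Complex.cpow_one, show γ + 1 - 1 = (γ - 1) + 1 by ring,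
        Complex.cpow_add _ _ hxt, Complex.cpow_one]
      push_cast
      field_simp
      ring
    have hint : ∫ t in (0 : ℝ)..x,
        msmIntegrand α α' β β' γ (fun t : ℝ => (t : ℂ) ^ (ρ - 1)) x t =
        (∫ t in (0 : ℝ)..x,
          msmIntegrand α (α' + 1) β β' γ (fun t : ℝ => (t : ℂ) ^ (ρ + 1 - 1)) x t) +
        β' / γ * ∫ t in (0 : ℝ)..x, msmIntegrand α (α' + 1) β (β' + 1) (γ + 1)
          (fun t : ℝ => (t : ℂ) ^ (ρ - 1)) x t := by
      rw [← intervalIntegral.integral_const_mul, ← intervalIntegral.integral_add i1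
        (i2.const_mul _), intervalIntegral.integral_of_le hx.le,
        intervalIntegral.integral_of_le hx.le, integral_Ioc_eq_integral_Ioo,
        integral_Ioc_eq_integral_Ioo]
      exact (setIntegral_congr_fun measurableSet_Ioo hcongr).symm
    constructor
    · have := i1.add (i2.const_mul (β' / γ))
      rw [intervalIntegrable_iff_integrableOn_Ioo_of_le hx.le] at this ⊢
      exact IntegrableOn.congr_fun this hcongr measurableSet_Ioo
    · have hsplit : msmIntegral α α' β β' γ (fun t : ℝ => (t : ℂ) ^ (ρ - 1)) x =
          msmIntegral α (α' + 1) β β' γ (fun t : ℝ => (t : ℂ) ^ (ρ + 1 - 1)) x +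
          β' * msmIntegral α (α' + 1) β (β' + 1) (γ + 1) (fun t : ℝ => (t : ℂ) ^ (ρ - 1)) x := by
        have hΓ := Complex.Gamma_ne_zero_of_re_pos hγ
        rw [msmIntegral, msmIntegral, msmIntegral, hint, Complex.Gamma_add_one γ hγ0]
        field_simp
      have hρ0 : ρ ≠ 0 := fun h => by simp [h] at hρ
      have e := Complex.one_div_Gamma_eq_self_mul_one_div_Gamma_add_one (ρ + β')
      rw [hsplit, v1, v2, msmMultiplier, msmMultiplier, msmMultiplier, e,
        Complex.Gamma_add_one ρ hρ0,
        show ρ + 1 - α - (α' + 1) + γ - 1 = ρ - α - α' + γ - 1 by ring,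
        show ρ - α - (α' + 1) + (γ + 1) - 1 = ρ - α - α' + γ - 1 by ring,
        show ρ + 1 + γ - α - (α' + 1) - β = ρ + γ - α - α' - β by ring,
        show ρ + 1 + β' - (α' + 1) = ρ + β' - α' by ring,
        show ρ + 1 + β' = ρ + β' + 1 by ring,
        show ρ + 1 + γ - α - (α' + 1) = ρ + γ - α - α' by ring,
        show ρ + 1 + γ - (α' + 1) - β = ρ + γ - α' - β by ring,
        show ρ + (γ + 1) - α - (α' + 1) - β = ρ + γ - α - α' - β by ring,
        show ρ + (β' + 1) - (α' + 1) = ρ + β' - α' by ring,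
        show ρ + (β' + 1) = ρ + β' + 1 by ring,
        show ρ + (γ + 1) - α - (α' + 1) = ρ + γ - α - α' by ring,
        show ρ + (γ + 1) - (α' + 1) - β = ρ + γ - α' - β by ring]
      ring

/-! ### Even power series -/

lemma Gamma_half_add_nat_mul_factorial (k : ℕ) :
    Complex.Gamma (1 / 2 + k) * (k.factorial : ℂ) * 4 ^ k =
      (Real.sqrt Real.pi : ℂ) * ((2 * k).factorial : ℂ) := by
  induction k with
  | zero =>
    have h := Complex.Gamma_one_half_eq
    simp only [Nat.cast_zero, add_zero, h]
    simp [Real.sqrt_eq_rpow, Complex.ofReal_cpow Real.pi_pos.le]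
  | succ k ih =>
    have h0 : (1 / 2 + k : ℂ) ≠ 0 := by
      intro h
      have := congrArg Complex.re h
      simp at this
      linarith [(Nat.cast_nonneg k : (0 : ℝ) ≤ k)]
    have h1 : ((2 * (k + 1)).factorial : ℂ) = (2 * k + 2) * (2 * k + 1) * (2 * k).factorial := by
      rw [show 2 * (k + 1) = 2 * k + 1 + 1 by ring, Nat.factorial_succ, Nat.factorial_succ]
      push_cast
      ring
    rw [h1, Nat.factorial_succ, Nat.cast_succ, ← add_assoc, Complex.Gamma_add_one _ h0]
    push_cast
    linear_combination (2 * k + 2) * (2 * k + 1) * ih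

lemma wrightTerm_eq_msmMultiplier (α α' β β' γ ρ z : ℂ) (k : ℕ) :
    wrightTerm ![(ρ, 2), (ρ + γ - α - α' - β, 2), (ρ + β' - α', 2)]
      ![(ρ + β', 2), (ρ + γ - α - α', 2), (ρ + γ - α' - β, 2), (1 / 2, 1)] (z / 4) k *
      (Real.sqrt Real.pi : ℂ) =
      msmMultiplier α α' β β' γ (ρ + (2 * k : ℕ)) * (z ^ k / ((2 * k).factorial : ℂ)) := by
  have hd := Gamma_half_add_nat_mul_factorial k
  have hG : Complex.Gamma (1 / 2 + k) ≠ 0 :=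
    Complex.Gamma_ne_zero_of_re_pos (by simp; positivity)
  have hk : (k.factorial : ℂ) ≠ 0 := by exact_mod_cast k.factorial_ne_zero
  have h2k : ((2 * k).factorial : ℂ) ≠ 0 := by exact_mod_cast (2 * k).factorial_ne_zero
  have h4 : (4 : ℂ) ^ k ≠ 0 := by simp
  have hscalar : (Complex.Gamma (1 / 2 + k))⁻¹ * ((z / 4) ^ k / (k.factorial : ℂ)) *
      (Real.sqrt Real.pi : ℂ) = z ^ k / ((2 * k).factorial : ℂ) := by
    generalize Complex.Gamma (1 / 2 + (k : ℂ)) = G at hd hG ⊢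
    rw [div_pow]
    field_simp
    linear_combination -z ^ k * hd
  rw [← hscalar, wrightTerm, msmMultiplier]
  simp only [Fin.prod_univ_succ, Fin.prod_univ_zero, Matrix.cons_val_zero, Matrix.cons_val_succ,
    Complex.ofReal_ofNat, Complex.ofReal_one, one_mul, mul_one]
  rw [show ρ + (2 * k : ℕ) + γ - α - α' - β = ρ + γ - α - α' - β + 2 * k by push_cast; ring,
    show ρ + (2 * k : ℕ) + β' - α' = ρ + β' - α' + 2 * k by push_cast; ring,
    show ρ + (2 * k : ℕ) + β' = ρ + β' + 2 * k by push_cast; ring,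
    show ρ + (2 * k : ℕ) + γ - α - α' = ρ + γ - α - α' + 2 * k by push_cast; ring,
    show ρ + (2 * k : ℕ) + γ - α' - β = ρ + γ - α' - β + 2 * k by push_cast; ring,
    show ρ + (2 * k : ℕ) = ρ + 2 * k by push_cast; ring]
  simp only [div_eq_mul_inv, mul_inv]
  ring

open MeasureTheory in
/-- The image of `t ^ (ρ - 1) g (c t)` for an entire function `g z = ∑ ε ^ k z ^ (2 k) / (2 k)!`;
the cases `ε = -1` and `ε = 1` are the cosine and the hyperbolic cosine. -/
theorem msm_power_mul_even {α α' β β' γ ρ : ℂ} (hγ : 0 < γ.re) (hρ : 0 < ρ.re)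
    (h1 : 0 < (ρ + β' - α').re) (h2 : 0 < (ρ + γ - α - α' - β).re) {x : ℝ} (hx : 0 < x)
    (c : ℂ) {ε : ℂ} (hε : ‖ε‖ ≤ 1) {g : ℂ → ℂ} (hg : Continuous g)
    (hgs : ∀ z, HasSum (fun k : ℕ => ε ^ k * z ^ (2 * k) / ((2 * k).factorial : ℂ)) (g z)) :
    IntervalIntegrable
        (msmIntegrand α α' β β' γ (fun t : ℝ => (t : ℂ) ^ (ρ - 1) * g (c * t)) x) volume 0 x ∧
      Summable (wrightTerm
          ![(ρ, 2), (ρ + γ - α - α' - β, 2), (ρ + β' - α', 2)]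
          ![(ρ + β', 2), (ρ + γ - α - α', 2), (ρ + γ - α' - β, 2), (1 / 2, 1)]
          (ε * (c ^ 2 * (x : ℂ) ^ 2) / 4)) ∧
      msmIntegral α α' β β' γ (fun t : ℝ => (t : ℂ) ^ (ρ - 1) * g (c * t)) x =
        (Real.sqrt Real.pi : ℂ) * (x : ℂ) ^ (ρ - α - α' + γ - 1) * wrightPsi
          ![(ρ, 2), (ρ + γ - α - α' - β, 2), (ρ + β' - α', 2)]
          ![(ρ + β', 2), (ρ + γ - α - α', 2), (ρ + γ - α' - β, 2), (1 / 2, 1)]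
          (ε * (c ^ 2 * (x : ℂ) ^ 2) / 4) := by
  have hxC : (x : ℂ) ≠ 0 := by exact_mod_cast hx.ne'
  set I : ℝ → ℂ := msmIntegrand α α' β β' γ (fun t : ℝ => (t : ℂ) ^ (ρ - 1)) x with hI
  have hI1 : IntervalIntegrable I volume 0 x := (msm_power hγ hρ h1 h2 hx).1
  have hfac : msmIntegrand α α' β β' γ (fun t : ℝ => (t : ℂ) ^ (ρ - 1) * g (c * t)) x =
      fun t => I t * g (c * t) := by
    funext t
    simp only [hI, msmIntegrand]
    ring
  set F : ℕ → ℝ → ℂ := fun k t =>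
    I t * (ε ^ k * (c * t) ^ (2 * k) / ((2 * k).factorial : ℂ)) with hF
  have hFint : ∀ k, Integrable (F k) (volume.restrict (Set.Ioo 0 x)) := fun k =>
    (intervalIntegrable_iff_integrableOn_Ioo_of_le hx.le).1
      (hI1.mul_continuousOn (by fun_prop))
  have hIint : Integrable I (volume.restrict (Set.Ioo 0 x)) :=
    (intervalIntegrable_iff_integrableOn_Ioo_of_le hx.le).1 hI1
  have hFsum : Summable fun k => ∫ t in Set.Ioo 0 x, ‖F k t‖ := by
    have hcosh : Summable fun k : ℕ => (‖c‖ * x) ^ (2 * k) / ((2 * k).factorial : ℝ) :=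
      (Real.hasSum_cosh (‖c‖ * x)).summable
    refine Summable.of_nonneg_of_le (fun k => integral_nonneg fun t => norm_nonneg _) (fun k => ?_)
      (hcosh.mul_left (∫ t in Set.Ioo 0 x, ‖I t‖))
    rw [← integral_mul_const]
    refine setIntegral_mono_on (hFint k).norm (hIint.norm.mul_const _) measurableSet_Ioo
      fun t ht => ?_
    simp only [hF, norm_mul, norm_div, norm_pow, Complex.norm_natCast, Complex.norm_real,
      Real.norm_of_nonneg ht.1.le]
    have hεk : ‖ε‖ ^ k ≤ 1 := pow_le_one₀ (norm_nonneg _) hε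
    have ht2 := ht.2.le
    have ht1 := ht.1.le
    calc _ ≤ ‖I t‖ * (1 * (‖c‖ * x) ^ (2 * k) / ((2 * k).factorial : ℝ)) := by gcongr
      _ = _ := by rw [one_mul]
  have hhas := hasSum_integral_of_summable_integral_norm hFint hFsum
  have htsum : ∀ t, ∑' k, F k t = I t * g (c * t) := fun t => by
    simp only [hF]
    rw [tsum_mul_left, (hgs (c * t)).tsum_eq]
  simp_rw [htsum] at hhas
  have hval : ∀ k, (x : ℂ) ^ (-α) / Complex.Gamma γ * ∫ t in Set.Ioo 0 x, F k t =
      ((Real.sqrt Real.pi : ℂ) * (x : ℂ) ^ (ρ - α - α' + γ - 1)) * wrightTerm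
        ![(ρ, 2), (ρ + γ - α - α' - β, 2), (ρ + β' - α', 2)]
        ![(ρ + β', 2), (ρ + γ - α - α', 2), (ρ + γ - α' - β, 2), (1 / 2, 1)]
        (ε * (c ^ 2 * (x : ℂ) ^ 2) / 4) k := by
    intro k
    have hk : (0 : ℝ) ≤ (2 * k : ℕ) := Nat.cast_nonneg _
    have hp := (msm_power (α := α) (α' := α') (β := β) (β' := β') (γ := γ) (ρ := ρ + (2 * k : ℕ))
      hγ (by rw [Complex.add_re, Complex.natCast_re]; positivity)
      (by simp only [Complex.add_re, Complex.sub_re, Complex.natCast_re] at h1 ⊢; linarith)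
      (by simp only [Complex.add_re, Complex.sub_re, Complex.natCast_re] at h2 ⊢; linarith) hx).2
    have hFk : ∫ t in Set.Ioo 0 x, F k t =
        (ε ^ k * c ^ (2 * k) / ((2 * k).factorial : ℂ)) * ∫ t in Set.Ioo 0 x,
          msmIntegrand α α' β β' γ (fun t : ℝ => (t : ℂ) ^ (ρ + (2 * k : ℕ) - 1)) x t := by
      rw [← integral_const_mul]
      refine setIntegral_congr_fun measurableSet_Ioo fun t ht => ?_
      have htC : (t : ℂ) ≠ 0 := by exact_mod_cast ht.1.ne'
      simp only [hF, hI, msmIntegrand]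
      rw [show ρ + (2 * k : ℕ) - 1 = ρ - 1 + (2 * k : ℕ) by ring, Complex.cpow_add _ _ htC,
        Complex.cpow_natCast, mul_pow]
      ring
    rw [msmIntegral, intervalIntegral.integral_of_le hx.le, integral_Ioc_eq_integral_Ioo] at hp
    have hw := wrightTerm_eq_msmMultiplier α α' β β' γ ρ (ε * (c ^ 2 * (x : ℂ) ^ 2)) k
    rw [show ρ + (2 * k : ℕ) - α - α' + γ - 1 = ρ - α - α' + γ - 1 + (2 * k : ℕ) by ring,
      Complex.cpow_add _ _ hxC, Complex.cpow_natCast] at hp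
    rw [mul_pow, mul_pow, ← pow_mul, ← pow_mul] at hw
    rw [hFk, mul_left_comm, hp]
    linear_combination -(x : ℂ) ^ (ρ - α - α' + γ - 1) * hw
  have hhas' := hhas.mul_left ((x : ℂ) ^ (-α) / Complex.Gamma γ)
  simp_rw [hval] at hhas'
  have hK : (Real.sqrt Real.pi : ℂ) * (x : ℂ) ^ (ρ - α - α' + γ - 1) ≠ 0 := by
    have : (Real.sqrt Real.pi : ℂ) ≠ 0 := by
      exact_mod_cast (Real.sqrt_pos.2 Real.pi_pos).ne'
    exact mul_ne_zero this (by simp [Complex.cpow_eq_zero_iff, hxC])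
  refine ⟨?_, (summable_mul_left_iff hK).1 hhas'.summable, ?_⟩
  · rw [hfac]
    exact hI1.mul_continuousOn (by fun_prop)
  · rw [msmIntegral, hfac, intervalIntegral.integral_of_le hx.le, integral_Ioc_eq_integral_Ioo,
      ← hhas'.tsum_eq, tsum_mul_left, wrightPsi]

/-! ### The cosine and the hyperbolic cosine -/

theorem mainTheorem5 (α α' β β' γ ρ c : ℂ) (hγ : 0 < γ.re)
    (hρ : max 0 (max (α + α' + β - γ).re (α' - β').re) < ρ.re) (x : ℝ) (hx : 0 < x) :
    (IntervalIntegrable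
        (msmIntegrand α α' β β' γ (fun t : ℝ => (t : ℂ) ^ (ρ - 1) * Complex.cos (c * t)) x)
        MeasureTheory.volume 0 x ∧
      Summable (wrightTerm
          ![(ρ, 2), (ρ + γ - α - α' - β, 2), (ρ + β' - α', 2)]
          ![(ρ + β', 2), (ρ + γ - α - α', 2), (ρ + γ - α' - β, 2), (1 / 2, 1)]
          (-(c ^ 2 * (x : ℂ) ^ 2 / 4))) ∧
      msmIntegral α α' β β' γ (fun t : ℝ => (t : ℂ) ^ (ρ - 1) * Complex.cos (c * t)) x =
        (Real.sqrt Real.pi : ℂ) * (x : ℂ) ^ (ρ - α - α' + γ - 1) * wrightPsi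
          ![(ρ, 2), (ρ + γ - α - α' - β, 2), (ρ + β' - α', 2)]
          ![(ρ + β', 2), (ρ + γ - α - α', 2), (ρ + γ - α' - β, 2), (1 / 2, 1)]
          (-(c ^ 2 * (x : ℂ) ^ 2 / 4))) ∧
    (IntervalIntegrable
        (msmIntegrand α α' β β' γ (fun t : ℝ => (t : ℂ) ^ (ρ - 1) * Complex.cosh (c * t)) x)
        MeasureTheory.volume 0 x ∧
      Summable (wrightTerm
          ![(ρ, 2), (ρ + γ - α - α' - β, 2), (ρ + β' - α', 2)]
          ![(ρ + β', 2), (ρ + γ - α - α', 2), (ρ + γ - α' - β, 2), (1 / 2, 1)]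
          (c ^ 2 * (x : ℂ) ^ 2 / 4)) ∧
      msmIntegral α α' β β' γ (fun t : ℝ => (t : ℂ) ^ (ρ - 1) * Complex.cosh (c * t)) x =
        (Real.sqrt Real.pi : ℂ) * (x : ℂ) ^ (ρ - α - α' + γ - 1) * wrightPsi
          ![(ρ, 2), (ρ + γ - α - α' - β, 2), (ρ + β' - α', 2)]
          ![(ρ + β', 2), (ρ + γ - α - α', 2), (ρ + γ - α' - β, 2), (1 / 2, 1)]
          (c ^ 2 * (x : ℂ) ^ 2 / 4)) := by
  simp only [max_lt_iff, Complex.add_re, Complex.sub_re] at hρ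
  obtain ⟨hρ0, hρ1, hρ2⟩ := hρ
  have h1 : 0 < (ρ + β' - α').re := by simp only [Complex.add_re, Complex.sub_re]; linarith
  have h2 : 0 < (ρ + γ - α - α' - β).re := by
    simp only [Complex.add_re, Complex.sub_re]
    linarith
  have e1 : -(c ^ 2 * (x : ℂ) ^ 2 / 4) = -1 * (c ^ 2 * (x : ℂ) ^ 2) / 4 := by ring
  have e2 : c ^ 2 * (x : ℂ) ^ 2 / 4 = 1 * (c ^ 2 * (x : ℂ) ^ 2) / 4 := by ring
  constructor
  · rw [e1]
    exact msm_power_mul_even hγ hρ0 h1 h2 hx c (by simp) Complex.continuous_cos Complex.hasSum_cos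
  · rw [e2]
    exact msm_power_mul_even hγ hρ0 h1 h2 hx c (by simp) Complex.continuous_cosh
      fun z => by simpa using Complex.hasSum_cosh z

end
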